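/- **Conventions.** Manifolds are smooth, Hausdorff and second countable. Let $(M,\pi)$ be a Poisson manifold of dimension $n$, with $\pi^\sharp:T^*M\to TM$, $\beta(\pi^\sharp\alpha)=\pi(\alpha,\beta)$. The rank of $\pi$ at $x$ is $\dim \pi^\sharp(T_x^*M)$, and the rank of $\pi$ is the maximum of these numbers. If $\pi$ has rank $2r$, a *completely integrable system* on $(M,\pi)$ is a regular foliation $\mathcal F$ of $M$ of rank (leaf dimension) $r$ such that any two functions which are defined on the same open set and are constant along the leaves of $\mathcal F$ Poisson-commute. The symplectic leaf $\mathcal S$ through a point consists of the points that can be reached from it along finitely many integral curves of Hamiltonian vector fields; $T_x\mathcal S=\pi^\sharp(T_x^*M)$. A symplectic leaf $\mathcal S$ of dimension $2r'$ is *$\mathcal F$-regular* if $\dim(T_x\mathcal F\cap T_x\mathcal S)=r'$ for all $x\in\mathcal S$. A *transversal* to $\mathcal S$ through $s\in\mathcal S$ is an (immersed) submanifold $\mathcal T$ of $M$ through $s$ with $T_sM=T_s\mathcal T\oplus T_s\mathcal S$. It is *$\mathcal F$-compatible* if, in a neighbourhood of $s$ in $\mathcal T$, $\mathcal F$ restricts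 to a regular foliation $\mathcal F_{\mathcal T}$ of rank $r-r'$, with tangent spaces $T_x\mathcal F\cap T_x\mathcal T$. An open subset $U$ of $\mathcal T$ is *Poisson–Dirac* with induced structure $\pi_{\mathcal T}$ if, at every $x\in U$, $T_x\mathcal T\cap\pi^\sharp((T_x\mathcal T)^\circ)=0$, where $(T_x\mathcal T)^\circ\subset T_x^*M$ is the annihilator of $T_x\mathcal T$, and $\pi_{\mathcal T}$ is the bivector field on $U$ determined by $\pi_{\mathcal T}(\alpha|_{T_x\mathcal T},\beta|_{T_x\mathcal T})=\pi(\alpha,\beta)$ for all $\alpha,\beta\in T_x^*M$ with $\pi^\sharp\alpha\in T_x\mathcal T$. **Proposition.** Let $(M,\pi)$ be a Poisson manifold of dimension $n$ and rank $2r$, $\mathcal F$ a completely integrable system on it, $\mathcal S$ an $\mathcal F$-regular symplectic leaf of dimension $2r'$, and $s\in\mathcal S$ a point such that $\pi$ has rank $2r$ on every neighbourhood of $s$ (that is, $s$ is a limit of points at which $\pi$ has rank $2r$). Let $\mathcal T$ be an $\mathcal F$-compatible transversal to $\mathcal S$ through $s$. Then $s$ has an open neighbourhood $U_0$ in $\mathcal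 T$ which is Poisson–Dirac, and for every open $U$ with $s\in U\subset U_0$ the induced bivector field $\pi_{\mathcal T}$ is a smooth Poisson structure on $U$, of rank $2(r-r')$, for which the induced foliation $\mathcal F_{\mathcal T}$ is a completely integrable system on $U$. -/

import Mathlib

open scoped Manifold ContDiff

/-! Throughout, a manifold of dimension `n` is modelled on `EuclideanSpace ℝ (Fin n)`, so that its
tangent space at `x` is `TangentSpace (𝓡 n) x`. -/

/-- The cotangent space `T*_x M`. -/
abbrev CotangentAt (n : ℕ) {M : Type*} [TopologicalSpace M]
    [ChartedSpace (EuclideanSpace ℝ (Fin n)) M] (x : M) : Type :=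
  TangentSpace (𝓡 n) x →L[ℝ] ℝ

/-- The differential `d_x f` of a real function, as a covector at `x`. -/
noncomputable def differentialAt (n : ℕ) {M : Type*} [TopologicalSpace M]
    [ChartedSpace (EuclideanSpace ℝ (Fin n)) M] (f : M → ℝ) (x : M) : CotangentAt n x :=
  mfderiv (𝓡 n) 𝓘(ℝ, ℝ) f x

/-- A field of bivectors `π` on `M`, given by its musical maps `π♯_x : T*_x M → T_x M`. The bivector
itself is `π_x(α, β) = β (π♯_x α)`, and `skew` says that it is skew-symmetric. -/
structure BivectorField (n : ℕ) (M : Type*) [TopologicalSpace M]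
    [ChartedSpace (EuclideanSpace ℝ (Fin n)) M] where
  sharp : ∀ x : M, CotangentAt n x →ₗ[ℝ] TangentSpace (𝓡 n) x
  skew : ∀ (x : M) (α β : CotangentAt n x), β (sharp x α) = -α (sharp x β)

/-- A distribution on `M`: a linear subspace of every tangent space. A foliation is represented by
the distribution `x ↦ T_x 𝓕` of the tangent spaces to its leaves. -/
abbrev TangentDistribution (n : ℕ) (M : Type*) [TopologicalSpace M]
    [ChartedSpace (EuclideanSpace ℝ (Fin n)) M] : Type _ :=
  ∀ x : M, Submodule ℝ (TangentSpace (𝓡 n) x)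

/-- `D` is, on the open set `U`, (the tangent distribution of) a regular foliation of rank `r`:
near every point the leaves are the fibres of a submersion to `ℝ^(n - r)`. -/
def IsRegularFoliationOn {n : ℕ} {M : Type*} [TopologicalSpace M]
    [ChartedSpace (EuclideanSpace ℝ (Fin n)) M] (D : TangentDistribution n M) (U : Set M)
    (r : ℕ) : Prop :=
  ∀ x ∈ U, ∃ V : Set M, IsOpen V ∧ x ∈ V ∧ V ⊆ U ∧
    ∃ (c : ℕ) (f : M → EuclideanSpace ℝ (Fin c)), r + c = n ∧
      ContMDiffOn (𝓡 n) (𝓡 c) ∞ f V ∧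
      ∀ y ∈ V, Function.Surjective (mfderiv (𝓡 n) (𝓡 c) f y) ∧
        ∀ v : TangentSpace (𝓡 n) y, v ∈ D y ↔ mfderiv (𝓡 n) (𝓡 c) f y v = 0

/-- `f` is, on the open set `V`, a section of the sheaf of smooth functions that are constant along
the leaves of the foliation `D`, that is, `df` vanishes on `D`. -/
def IsFirstIntegralOn {n : ℕ} {M : Type*} [TopologicalSpace M]
    [ChartedSpace (EuclideanSpace ℝ (Fin n)) M] (D : TangentDistribution n M) (V : Set M)
    (f : M → ℝ) : Prop :=
  ContMDiffOn (𝓡 n) 𝓘(ℝ, ℝ) ∞ f V ∧ ∀ x ∈ V, ∀ v ∈ D x, differentialAt n f x v = 0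

namespace BivectorField

variable {n : ℕ} {M : Type*} [TopologicalSpace M] [ChartedSpace (EuclideanSpace ℝ (Fin n)) M]

/-- The bracket `{f, g}(x) = π_x(d_x f, d_x g)`. -/
noncomputable def bracket (π : BivectorField n M) (f g : M → ℝ) (x : M) : ℝ :=
  differentialAt n g x (π.sharp x (differentialAt n f x))

/-- `π` is a (smooth) Poisson structure on the open set `U`: the bracket of smooth functions on `U`
is smooth and satisfies the Jacobi identity. -/
def IsPoissonOn (π : BivectorField n M) (U : Set M) : Prop :=
  (∀ f g : M → ℝ, ContMDiffOn (𝓡 n) 𝓘(ℝ, ℝ) ∞ f U → ContMDiffOn (𝓡 n) 𝓘(ℝ, ℝ) ∞ g U →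
    ContMDiffOn (𝓡 n) 𝓘(ℝ, ℝ) ∞ (π.bracket f g) U) ∧
  ∀ f g h : M → ℝ, ContMDiffOn (𝓡 n) 𝓘(ℝ, ℝ) ∞ f U → ContMDiffOn (𝓡 n) 𝓘(ℝ, ℝ) ∞ g U →
    ContMDiffOn (𝓡 n) 𝓘(ℝ, ℝ) ∞ h U → ∀ x ∈ U,
      π.bracket f (π.bracket g h) x + π.bracket g (π.bracket h f) x +
        π.bracket h (π.bracket f g) x = 0

/-- The characteristic subspace `π♯(T*_x M)`, spanned by the Hamiltonian vectors at `x`. It is the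
tangent space at `x` of the symplectic leaf through `x`. -/
noncomputable def leafTangent (π : BivectorField n M) (x : M) : Submodule ℝ (TangentSpace (𝓡 n) x) :=
  LinearMap.range (π.sharp x)

/-- The rank of `π` at a point. -/
noncomputable def rankAt (π : BivectorField n M) (x : M) : ℕ :=
  Module.finrank ℝ (π.leafTangent x)

/-- The rank of `π` on `U` is the maximum over `U` of its pointwise ranks. -/
def HasRankOn (π : BivectorField n M) (U : Set M) (ρ : ℕ) : Prop :=
  IsGreatest (π.rankAt '' U) ρ

/-- The Hamiltonian vector field `X_h = π♯(dh)`. -/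
noncomputable def hamiltonianField (π : BivectorField n M) (h : M → ℝ) (x : M) :
    TangentSpace (𝓡 n) x :=
  π.sharp x (differentialAt n h x)

/-- `y` is reached from `x` along an integral curve of a Hamiltonian vector field. -/
def HamiltonianStep (π : BivectorField n M) (x y : M) : Prop :=
  ∃ h : M → ℝ, ContMDiff (𝓡 n) 𝓘(ℝ, ℝ) ∞ h ∧ ∃ γ : ℝ → M,
    IsMIntegralCurveOn (I := 𝓡 n) γ (π.hamiltonianField h) (Set.Icc 0 1) ∧ γ 0 = x ∧ γ 1 = y

/-- The symplectic leaves: the classes of points that can be joined by a finite concatenation of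
integral curves of Hamiltonian vector fields. -/
def IsSymplecticLeaf (π : BivectorField n M) (S : Set M) : Prop :=
  ∃ x : M, S = {y | Relation.ReflTransGen π.HamiltonianStep x y}

/-- The foliation `D` is a completely integrable system on the open set `U` for the Poisson
structure `π`: if `π` has rank `2 r` on `U`, then `D` is a regular foliation of rank `r` on `U`, and
any two locally defined functions constant along its leaves are in involution. -/
def IsCompletelyIntegrableOn (π : BivectorField n M) (D : TangentDistribution n M) (U : Set M)
    (r : ℕ) : Prop :=
  π.HasRankOn U (2 * r) ∧ IsRegularFoliationOn D U r ∧
    ∀ V : Set M, IsOpen V → V ⊆ U → ∀ f g : M → ℝ,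
      IsFirstIntegralOn D V f → IsFirstIntegralOn D V g → ∀ x ∈ V, π.bracket f g x = 0

/-- The symplectic leaf `S` is regular for the foliation `D`: at each of its points the tangent
spaces of `S` and of the leaf of the foliation meet in dimension `dim S / 2`. -/
def IsRegularLeafFor (π : BivectorField n M) (D : TangentDistribution n M) (S : Set M) : Prop :=
  ∀ x ∈ S, 2 * Module.finrank ℝ ↥(D x ⊓ π.leafTangent x) = Module.finrank ℝ (π.leafTangent x)

end BivectorField

section Submanifold

variable {n k : ℕ} {M : Type*} [TopologicalSpace M] [ChartedSpace (EuclideanSpace ℝ (Fin n)) M]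
  {T : Type*} [TopologicalSpace T] [ChartedSpace (EuclideanSpace ℝ (Fin k)) T]

/-- The differential of `ι : T → M` at `x`. -/
noncomputable def tangentMapAt (n k : ℕ) {M : Type*} [TopologicalSpace M]
    [ChartedSpace (EuclideanSpace ℝ (Fin n)) M] {T : Type*} [TopologicalSpace T]
    [ChartedSpace (EuclideanSpace ℝ (Fin k)) T] (ι : T → M) (x : T) :
    TangentSpace (𝓡 k) x →L[ℝ] TangentSpace (𝓡 n) (ι x) :=
  mfderiv (𝓡 k) (𝓡 n) ι x

/-- The tangent space of the submanifold `ι : T → M`, as a subspace of `T_{ι x} M`. -/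
noncomputable def submanifoldTangent (n k : ℕ) {M : Type*} [TopologicalSpace M]
    [ChartedSpace (EuclideanSpace ℝ (Fin n)) M] {T : Type*} [TopologicalSpace T]
    [ChartedSpace (EuclideanSpace ℝ (Fin k)) T] (ι : T → M) (x : T) :
    Submodule ℝ (TangentSpace (𝓡 n) (ι x)) :=
  LinearMap.range (tangentMapAt n k ι x).toLinearMap

/-- The submanifold `ι : T → M` is transversal at `t` to the symplectic leaf through `ι t`, with
complementary dimension: `T_s M = T_s T ⊕ T_s S` at `s = ι t`. -/
def IsTransversalAt (π : BivectorField n M) (ι : T → M) (t : T) : Prop :=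
  IsCompl (submanifoldTangent n k ι t) (π.leafTangent (ι t))

/-- The restriction of a foliation to the submanifold `ι : T → M`, with tangent spaces
`T_x T ∩ T_x 𝓕`. -/
noncomputable def restrictDistribution (n k : ℕ) {M : Type*} [TopologicalSpace M]
    [ChartedSpace (EuclideanSpace ℝ (Fin n)) M] {T : Type*} [TopologicalSpace T]
    [ChartedSpace (EuclideanSpace ℝ (Fin k)) T] (D : TangentDistribution n M) (ι : T → M) :
    TangentDistribution k T :=
  fun x => (D (ι x)).comap (tangentMapAt n k ι x).toLinearMap

/-- The foliation `D` restricts, near `t`, to a regular foliation of rank `ρ` on `T`. -/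
def IsCompatibleAt (D : TangentDistribution n M) (ι : T → M) (t : T) (ρ : ℕ) : Prop :=
  ∃ V : Set T, IsOpen V ∧ t ∈ V ∧ IsRegularFoliationOn (restrictDistribution n k D ι) V ρ

/-- The bivector field `πT` is on `U` the Poisson–Dirac structure induced by `π` on the submanifold
`ι : T → M`: at each point `T_x T ∩ π♯((T_x T)°) = 0`, where `(T_x T)°` is the space of covectors of
`M` that vanish on `T_x T`, and `πT(α|T, β|T) = π(α, β)` for all covectors `α`, `β` of `M` at `x`
with `π♯ α` tangent to `T`. By the first condition, every covector of `T` is the restriction of such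
an `α`, so that `πT` is determined on `U`. -/
def IsInducedPoissonDiracOn (π : BivectorField n M) (ι : T → M) (πT : BivectorField k T)
    (U : Set T) : Prop :=
  ∀ x ∈ U,
    (∀ α : CotangentAt n (ι x), (∀ v ∈ submanifoldTangent n k ι x, α v = 0) →
      π.sharp (ι x) α ∈ submanifoldTangent n k ι x → π.sharp (ι x) α = 0) ∧
    ∀ α β : CotangentAt n (ι x), π.sharp (ι x) α ∈ submanifoldTangent n k ι x →
      (β.comp (tangentMapAt n k ι x)) (πT.sharp x (α.comp (tangentMapAt n k ι x))) =
        β (π.sharp (ι x) α)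

end Submanifold

/-! At `t`, the tangent space of the transversal and the characteristic subspace are complementary,
so the block of `π` in conormal directions is invertible (`isInvertible_of_isTransversalAt`).
Invertibility is an open condition, and where it holds the submanifold satisfies more than the
Poisson–Dirac condition: `π♯` is injective on conormal covectors and sends them to a complement of
the tangent space. Let `P` be the projection onto the tangent space along this complement. The
induced structure is then `P ∘ π♯ ∘ P*`, and everything but smoothness, Jacobi and attainment of the
rank is pointwise linear algebra.

Rank: the complement has dimension `n - k = 2 r'` and lies in the image of `π♯`, so the induced rank
is the rank of `π` minus `2 r'` (`finrank_range_induced_sharp`). This bounds it by `2 (r - r')`. To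
see that the bound is attained arbitrarily close to `t`, take a point of `M` near `ι t` where `π`
has rank `2 r` and move it onto the transversal along the characteristic distribution; by the Jacobi
identity the rank cannot drop on the way (`eventually_exists_rank_le_on_fiber`).

Smoothness and Jacobi: every function on the transversal extends locally to one whose Hamiltonian
field is tangent to it (`hasTangentExtensions`), and brackets of such extensions restrict to the
induced brackets (`IsInducedPoissonDiracOn.isPoissonOn`).

Involution: complete integrability says that each `T_x 𝓕` is coisotropic (`apply_sharp_eq_zero`). A
dimension count shows that `P` maps `T_x 𝓕` into its intersection with the tangent space of the
transversal, so this intersection is coisotropic too (`induced_sharp_involutive`). -/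

section LinearAlgebra

/-! ### Linear algebra of subspaces transverse to a bivector. -/

set_option linter.unusedSectionVars false

theorem finrank_map_of_disjoint_ker {V W : Type*} [AddCommGroup V] [Module ℝ V] [AddCommGroup W]
    [Module ℝ W] (f : V →ₗ[ℝ] W) (S : Submodule ℝ V) (h : ∀ x ∈ S, f x = 0 → x = 0) :
    Module.finrank ℝ (S.map f) = Module.finrank ℝ S := by
  have hinj : Function.Injective (f.domRestrict S) := by
    rw [injective_iff_map_eq_zero]
    rintro ⟨x, hx⟩ h0
    exact Subtype.ext (h x hx h0)
  rw [← LinearMap.finrank_range_of_inj hinj, LinearMap.range_domRestrict]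

variable {V V' : Type*} [AddCommGroup V] [Module ℝ V] [TopologicalSpace V]
  [IsTopologicalAddGroup V] [ContinuousSMul ℝ V] [T2Space V] [FiniteDimensional ℝ V]
  [AddCommGroup V'] [Module ℝ V'] [TopologicalSpace V']
  [IsTopologicalAddGroup V'] [ContinuousSMul ℝ V'] [T2Space V'] [FiniteDimensional ℝ V']

/-- The continuous linear forms that vanish on a submodule. -/
def continuousAnnihilator (W : Submodule ℝ V) : Submodule ℝ (V →L[ℝ] ℝ) where
  carrier := {α | ∀ w ∈ W, α w = 0}
  add_mem' := fun ha hb w hw => by simp [ha w hw, hb w hw]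
  zero_mem' := fun w _ => rfl
  smul_mem' := fun c α ha w hw => by simp [ha w hw]

theorem mem_continuousAnnihilator {W : Submodule ℝ V} {α : V →L[ℝ] ℝ} :
    α ∈ continuousAnnihilator W ↔ ∀ w ∈ W, α w = 0 := Iff.rfl

theorem finrank_continuousAnnihilator_add (W : Submodule ℝ V) :
    Module.finrank ℝ (continuousAnnihilator W) + Module.finrank ℝ W = Module.finrank ℝ V := by
  have e : W.dualAnnihilator.map
      (LinearMap.toContinuousLinearMap : (V →ₗ[ℝ] ℝ) ≃ₗ[ℝ] (V →L[ℝ] ℝ)).toLinearMap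
      = continuousAnnihilator W := by
    ext α
    simp only [Submodule.mem_map, Submodule.mem_dualAnnihilator, mem_continuousAnnihilator]
    constructor
    · rintro ⟨β, hβ, rfl⟩ w hw
      exact hβ w hw
    · intro h
      exact ⟨α.toLinearMap, h, by ext; rfl⟩
  rw [← e, LinearEquiv.finrank_map_eq, add_comm]
  exact Subspace.finrank_add_finrank_dualAnnihilator_eq W

theorem mem_of_forall_continuousAnnihilator {W : Submodule ℝ V} {v : V}
    (h : ∀ α ∈ continuousAnnihilator W, α v = 0) : v ∈ W := by
  by_contra hv
  obtain ⟨f, hf, hW⟩ := Submodule.exists_le_ker_of_notMem hv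
  exact hf (h (LinearMap.toContinuousLinearMap f) fun w hw => hW hw)

theorem ext_of_forall_continuousDual {v w : V} (h : ∀ α : V →L[ℝ] ℝ, α v = α w) : v = w := by
  have : v - w ∈ (⊥ : Submodule ℝ V) :=
    mem_of_forall_continuousAnnihilator fun α _ => by rw [map_sub, h, sub_self]
  exact sub_eq_zero.1 ((Submodule.mem_bot ℝ).1 this)

variable {sharp : (V →L[ℝ] ℝ) →ₗ[ℝ] V} {j : V' →L[ℝ] V}

/-- The map `sharp` is injective on the annihilator, whose dimension is the codimension of the
subspace; a trivial intersection therefore already gives a complement. -/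
theorem isCompl_range_map_annihilator
    (nondeg : ∀ α ∈ continuousAnnihilator j.range, sharp α ∈ j.range → α = 0) :
    IsCompl j.range ((continuousAnnihilator j.range).map sharp) := by
  have hd : Disjoint j.range ((continuousAnnihilator j.range).map sharp) := by
    rw [Submodule.disjoint_def]
    rintro _ hx ⟨α, hα, rfl⟩
    rw [nondeg α hα hx, map_zero]
  refine ⟨hd, codisjoint_iff.2 (Submodule.eq_top_of_finrank_eq ?_)⟩
  have h1 := Submodule.finrank_sup_add_finrank_inf_eq j.range
    ((continuousAnnihilator j.range).map sharp)
  rw [hd.eq_bot, finrank_bot, add_zero] at h1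
  rw [h1, ← finrank_continuousAnnihilator_add j.range, add_comm]
  congr 1
  exact finrank_map_of_disjoint_ker _ _ fun α hα h0 => nondeg α hα (h0 ▸ zero_mem _)

theorem exists_poissonDirac_projection (hj : Function.Injective j)
    (nondeg : ∀ α ∈ continuousAnnihilator j.range, sharp α ∈ j.range → α = 0) :
    ∃ P : V →L[ℝ] V', (∀ v, P (j v) = v) ∧
      (∀ α ∈ continuousAnnihilator j.range, P (sharp α) = 0) ∧
      ∀ v, v - j (P v) ∈ (continuousAnnihilator j.range).map sharp := by
  have hc := isCompl_range_map_annihilator nondeg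
  let e := LinearEquiv.ofInjective j.toLinearMap hj
  let P₀ : V →ₗ[ℝ] V' := e.symm.toLinearMap ∘ₗ j.range.projectionOnto _ hc
  have hP1 : ∀ v, P₀ (j v) = v := fun v => by
    have h1 := Submodule.projectionOnto_apply_left hc ⟨j v, v, rfl⟩
    have h2 : P₀ (j v) = e.symm (j.range.projectionOnto _ hc (j v)) := rfl
    rw [h2, h1]
    exact e.symm_apply_apply v
  have hP2 : ∀ v ∈ (continuousAnnihilator j.range).map sharp, P₀ v = 0 := fun v hv => by
    have h1 := (Submodule.projectionOnto_apply_eq_zero_iff hc).2 hv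
    have h2 : P₀ v = e.symm (j.range.projectionOnto _ hc v) := rfl
    rw [h2, h1, map_zero]
  refine ⟨LinearMap.toContinuousLinearMap P₀, hP1, fun α hα => hP2 _ ⟨α, hα, rfl⟩, fun v => ?_⟩
  have hv : v ∈ j.range ⊔ (continuousAnnihilator j.range).map sharp := by
    rw [hc.sup_eq_top]; trivial
  obtain ⟨_, ⟨u, rfl⟩, w, hw, rfl⟩ := Submodule.mem_sup.1 hv
  have : P₀ (j u + w) = u := by rw [map_add, hP1, hP2 w hw, add_zero]
  change j u + w - j (P₀ (j u + w)) ∈ _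
  rw [this, add_sub_cancel_left]
  exact hw

theorem sharp_comp_projection_mem_range
    (skew : ∀ α β : V →L[ℝ] ℝ, β (sharp α) = -α (sharp β)) {P : V →L[ℝ] V'}
    (hP : ∀ α ∈ continuousAnnihilator j.range, P (sharp α) = 0) (φ : V' →L[ℝ] ℝ) :
    sharp (φ.comp P) ∈ j.range := by
  refine mem_of_forall_continuousAnnihilator fun β hβ => ?_
  rw [skew, ContinuousLinearMap.comp_apply, hP β hβ, map_zero, neg_zero]

variable {sharpT : (V' →L[ℝ] ℝ) →ₗ[ℝ] V'}

/-- The covector `φ ∘ P` is the extension of `φ` whose image under `sharp` is tangent. The defining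
relation of the induced bivector, tested on it, determines `sharpT`. -/
theorem apply_induced_sharp
    (skew : ∀ α β : V →L[ℝ] ℝ, β (sharp α) = -α (sharp β)) {P : V →L[ℝ] V'}
    (hPj : ∀ v, P (j v) = v)
    (hP : ∀ α ∈ continuousAnnihilator j.range, P (sharp α) = 0)
    (hT : ∀ α β : V →L[ℝ] ℝ, sharp α ∈ j.range →
      (β.comp j) (sharpT (α.comp j)) = β (sharp α)) (φ : V' →L[ℝ] ℝ) :
    j (sharpT φ) = sharp (φ.comp P) := by
  refine ext_of_forall_continuousDual fun β => ?_
  rw [← hT _ β (sharp_comp_projection_mem_range skew hP φ)]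
  have : (φ.comp P).comp j = φ := by ext v; simp [hPj]
  rw [this]; rfl

/-- The image of `sharp` splits as the image of `sharpT` plus the complement `sharp (j.range)°`,
whose dimension is the codimension of `j`. -/
theorem finrank_range_induced_sharp (hj : Function.Injective j)
    (skew : ∀ α β : V →L[ℝ] ℝ, β (sharp α) = -α (sharp β))
    (nondeg : ∀ α ∈ continuousAnnihilator j.range, sharp α ∈ j.range → α = 0)
    (hT : ∀ α β : V →L[ℝ] ℝ, sharp α ∈ j.range →
      (β.comp j) (sharpT (α.comp j)) = β (sharp α)) :
    Module.finrank ℝ (LinearMap.range sharpT) + Module.finrank ℝ V =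
      Module.finrank ℝ (LinearMap.range sharp) + Module.finrank ℝ V' := by
  obtain ⟨P, hPj, hP, -⟩ := exists_poissonDirac_projection hj nondeg
  have key := apply_induced_sharp skew hPj hP hT
  have hc := isCompl_range_map_annihilator nondeg
  have hle : (LinearMap.range sharpT).map j.toLinearMap ≤ j.range := by
    rintro _ ⟨v, _, rfl⟩; exact ⟨v, rfl⟩
  have hsup : LinearMap.range sharp =
      (LinearMap.range sharpT).map j.toLinearMap ⊔ (continuousAnnihilator j.range).map sharp := by
    apply le_antisymm
    · rintro _ ⟨α, rfl⟩
      -- Since `P ∘ j = id`, the second summand vanishes on `j.range`.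
      have hα : α = (α.comp j).comp P + (α - (α.comp j).comp P) := by abel
      rw [hα, map_add]
      refine add_mem (Submodule.mem_sup_left ?_) (Submodule.mem_sup_right ⟨_, ?_, rfl⟩)
      · rw [← key]
        exact ⟨_, ⟨_, rfl⟩, rfl⟩
      · rintro _ ⟨v, rfl⟩
        simp [hPj]
    · refine sup_le ?_ ?_
      · rintro _ ⟨_, ⟨φ, rfl⟩, rfl⟩
        exact ⟨φ.comp P, (key φ).symm⟩
      · rintro _ ⟨α, _, rfl⟩
        exact ⟨α, rfl⟩
  have h1 := Submodule.finrank_sup_add_finrank_inf_eq ((LinearMap.range sharpT).map j.toLinearMap)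
    ((continuousAnnihilator j.range).map sharp)
  rw [(hc.disjoint.mono_left hle).eq_bot, finrank_bot, add_zero, ← hsup,
    finrank_map_of_disjoint_ker _ _ fun x _ hx => hj (hx.trans j.map_zero.symm)] at h1
  have h2 := Submodule.finrank_add_eq_of_isCompl hc
  have h3 : Module.finrank ℝ j.range = Module.finrank ℝ V' := LinearMap.finrank_range_of_inj hj
  omega

/-- A Poisson–Dirac subspace whose tangent part of a coisotropic subspace `D` has the expected
dimension inherits a coisotropic subspace. -/
theorem induced_sharp_involutive (hj : Function.Injective j)
    (skew : ∀ α β : V →L[ℝ] ℝ, β (sharp α) = -α (sharp β))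
    (nondeg : ∀ α ∈ continuousAnnihilator j.range, sharp α ∈ j.range → α = 0)
    (hT : ∀ α β : V →L[ℝ] ℝ, sharp α ∈ j.range →
      (β.comp j) (sharpT (α.comp j)) = β (sharp α))
    {D : Submodule ℝ V} {d : ℕ}
    (hD : ∀ α ∈ continuousAnnihilator D, ∀ β ∈ continuousAnnihilator D, β (sharp α) = 0)
    (hdim : Module.finrank ℝ (D.comap j.toLinearMap) + d = Module.finrank ℝ D)
    (hV : Module.finrank ℝ V' + 2 * d = Module.finrank ℝ V) {φ φ' : V' →L[ℝ] ℝ}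
    (hφ : ∀ v ∈ D.comap j.toLinearMap, φ v = 0) (hφ' : ∀ v ∈ D.comap j.toLinearMap, φ' v = 0) :
    φ' (sharpT φ) = 0 := by
  obtain ⟨P, hPj, hP, hN⟩ := exists_poissonDirac_projection hj nondeg
  have key := apply_induced_sharp skew hPj hP hT
  -- The projection onto the complement `N = sharp (j.range)°`, which has dimension `2 d`. The aim
  -- is that `Q = p(D)`, of dimension `d`, lies in `D`; then `P` maps `D` into itself.
  let p : V →ₗ[ℝ] V := LinearMap.id - j.toLinearMap ∘ₗ P.toLinearMap
  have hp : ∀ v, p v = v - j (P v) := fun v => rfl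
  set Q := D.map p with hQ
  have hQfin : Module.finrank ℝ Q = d := by
    have h := LinearMap.finrank_range_add_finrank_ker (p.domRestrict D)
    have h1 : LinearMap.range (p.domRestrict D) = Q := by ext v; simp [hQ]
    have h2 : Module.finrank ℝ (LinearMap.ker (p.domRestrict D)) =
        Module.finrank ℝ (D.comap j.toLinearMap) := by
      have h3 : (LinearMap.ker (p.domRestrict D)).map D.subtype =
          (D.comap j.toLinearMap).map j.toLinearMap := by
        ext v
        constructor
        · rintro ⟨w, hw, rfl⟩
          have hw' : (w : V) - j (P w) = 0 := hw
          exact ⟨P w, by change j (P w) ∈ D; rw [← sub_eq_zero.1 hw']; exact w.2,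
            (sub_eq_zero.1 hw').symm⟩
        · rintro ⟨w, hw, rfl⟩
          refine ⟨⟨j w, hw⟩, ?_, rfl⟩
          change j w - j (P (j w)) = 0
          rw [hPj, sub_self]
      rw [← Submodule.finrank_map_subtype_eq, h3,
        finrank_map_of_disjoint_ker _ _ fun x _ hx => hj (hx.trans j.map_zero.symm)]
    rw [h1, h2] at h
    omega
  -- As `D ⊆ j.range + Q`, the space `R` annihilates `D`, so `sharp R ⊆ D` by coisotropy. It also
  -- lies in `N`, where `p` is the identity, hence in `Q`. Since `dim R ≥ d = dim Q`, equality
  -- `sharp R = Q` follows.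
  set R := continuousAnnihilator (j.range ⊔ Q) with hR
  have hRj : R ≤ continuousAnnihilator j.range := fun β hβ w hw =>
    hβ w (Submodule.mem_sup_left hw)
  have hRD : R ≤ continuousAnnihilator D := fun β hβ w hw => by
    have h1 := hβ (p w) (Submodule.mem_sup_right ⟨w, hw, rfl⟩)
    rw [hp, map_sub, hβ (j (P w)) (Submodule.mem_sup_left ⟨_, rfl⟩), sub_zero] at h1
    exact h1
  have hRfin : d ≤ Module.finrank ℝ R := by
    have h1 := finrank_continuousAnnihilator_add (j.range ⊔ Q)
    have h2 := Submodule.finrank_add_le_finrank_add_finrank j.range Q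
    have h3 : Module.finrank ℝ j.range = Module.finrank ℝ V' := LinearMap.finrank_range_of_inj hj
    rw [← hR] at h1
    omega
  have hsR : R.map sharp ≤ D ⊓ Q := by
    rintro _ ⟨β, hβ, rfl⟩
    have hmem : sharp β ∈ D :=
      mem_of_forall_continuousAnnihilator fun α hα => hD β (hRD hβ) α hα
    refine ⟨hmem, sharp β, hmem, ?_⟩
    rw [hp, hP β (hRj hβ), map_zero, sub_zero]
  have hfin : Module.finrank ℝ (R.map sharp) = Module.finrank ℝ R :=
    finrank_map_of_disjoint_ker _ _ fun α hα h0 => nondeg α (hRj hα) (h0 ▸ zero_mem _)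
  have hQD : Q ≤ D := by
    have h1 : R.map sharp = Q := Submodule.eq_of_le_of_finrank_le (hsR.trans inf_le_right)
      (by omega)
    exact h1 ▸ hsR.trans inf_le_left
  have hPD : ∀ v ∈ D, P v ∈ D.comap j.toLinearMap := fun v hv => by
    have h1 : p v ∈ D := hQD ⟨v, hv, rfl⟩
    have h2 : j (P v) = v - p v := by rw [hp]; abel
    change j (P v) ∈ D
    rw [h2]
    exact sub_mem hv h1
  have : sharpT φ = P (sharp (φ.comp P)) := by rw [← key, hPj]
  rw [this]
  exact hD (φ.comp P) (fun v hv => hφ _ (hPD v hv)) (φ'.comp P) fun v hv => hφ' _ (hPD v hv)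

end LinearAlgebra

section LocalBracket

/-! ### Locality of the bracket, and its use on locally defined functions. -/

open scoped Topology

variable {n : ℕ} {M : Type*} [TopologicalSpace M] [ChartedSpace (EuclideanSpace ℝ (Fin n)) M]

theorem differentialAt_congr {f g : M → ℝ} {x : M} (h : f =ᶠ[𝓝 x] g) :
    differentialAt n f x = differentialAt n g x := h.mfderiv_eq

namespace BivectorField

variable {π : BivectorField n M}

theorem bracket_congr {f f' g g' : M → ℝ} {x : M} (hf : f =ᶠ[𝓝 x] f') (hg : g =ᶠ[𝓝 x] g') :
    π.bracket f g x = π.bracket f' g' x := by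
  simp only [bracket, differentialAt_congr hf, differentialAt_congr hg]

theorem bracket_eventuallyEq {f f' g g' : M → ℝ} {x : M} (hf : f =ᶠ[𝓝 x] f')
    (hg : g =ᶠ[𝓝 x] g') : π.bracket f g =ᶠ[𝓝 x] π.bracket f' g' := by
  filter_upwards [hf.eventuallyEq_nhds, hg.eventuallyEq_nhds] with y hfy hgy
  exact bracket_congr hfy hgy

end BivectorField

theorem exists_contMDiff_eventuallyEq [T2Space M] [IsManifold (𝓡 n) ∞ M] {f : M → ℝ} {O : Set M}
    {x : M} (hO : O ∈ 𝓝 x) (hf : ContMDiffOn (𝓡 n) 𝓘(ℝ, ℝ) ∞ f O) :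
    ∃ g : M → ℝ, ContMDiff (𝓡 n) 𝓘(ℝ, ℝ) ∞ g ∧ g =ᶠ[𝓝 x] f := by
  obtain ⟨χ, -, hχ⟩ := (SmoothBumpFunction.nhds_basis_tsupport (I := 𝓡 n) x).mem_iff.1
    (interior_mem_nhds.2 hO)
  refine ⟨fun y => χ y * f y, contMDiff_of_tsupport fun y hy => ?_, ?_⟩
  · have hy' : y ∈ interior O := hχ (tsupport_mul_subset_left hy)
    exact χ.contMDiffAt.mul (hf.contMDiffAt (mem_interior_iff_mem_nhds.1 hy'))
  · filter_upwards [χ.eventuallyEq_one] with y hy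
    simp [hy]

namespace BivectorField

variable {π : BivectorField n M} [T2Space M] [IsManifold (𝓡 n) ∞ M]

theorem IsPoissonOn.contMDiffAt_bracket (hπ : π.IsPoissonOn Set.univ) {f g : M → ℝ} {O : Set M}
    {x : M} (hO : O ∈ 𝓝 x) (hf : ContMDiffOn (𝓡 n) 𝓘(ℝ, ℝ) ∞ f O)
    (hg : ContMDiffOn (𝓡 n) 𝓘(ℝ, ℝ) ∞ g O) :
    ContMDiffAt (𝓡 n) 𝓘(ℝ, ℝ) ∞ (π.bracket f g) x := by
  obtain ⟨f', hf', hff'⟩ := exists_contMDiff_eventuallyEq hO hf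
  obtain ⟨g', hg', hgg'⟩ := exists_contMDiff_eventuallyEq hO hg
  exact ((hπ.1 f' g' hf'.contMDiffOn hg'.contMDiffOn).contMDiffAt Filter.univ_mem).congr_of_eventuallyEq
    (bracket_eventuallyEq hff' hgg').symm

theorem IsPoissonOn.jacobi_of_contMDiffOn (hπ : π.IsPoissonOn Set.univ) {f g h : M → ℝ} {O : Set M}
    {x : M} (hO : O ∈ 𝓝 x) (hf : ContMDiffOn (𝓡 n) 𝓘(ℝ, ℝ) ∞ f O)
    (hg : ContMDiffOn (𝓡 n) 𝓘(ℝ, ℝ) ∞ g O) (hh : ContMDiffOn (𝓡 n) 𝓘(ℝ, ℝ) ∞ h O) :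
    π.bracket f (π.bracket g h) x + π.bracket g (π.bracket h f) x +
        π.bracket h (π.bracket f g) x = 0 := by
  obtain ⟨f', hf', hff'⟩ := exists_contMDiff_eventuallyEq hO hf
  obtain ⟨g', hg', hgg'⟩ := exists_contMDiff_eventuallyEq hO hg
  obtain ⟨h', hh', hhh'⟩ := exists_contMDiff_eventuallyEq hO hh
  rw [← hπ.2 f' g' h' hf'.contMDiffOn hg'.contMDiffOn hh'.contMDiffOn x trivial,
    bracket_congr hff' (bracket_eventuallyEq hgg' hhh'),
    bracket_congr hgg' (bracket_eventuallyEq hhh' hff'),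
    bracket_congr hhh' (bracket_eventuallyEq hff' hgg')]

end BivectorField

end LocalBracket

/-! ### The Poisson tensor in a chart. -/

theorem hasFDerivAt_dual_apply {E : Type*} [NormedAddCommGroup E] [NormedSpace ℝ E]
    {A : E → (E →L[ℝ] ℝ) →L[ℝ] E} {z : E} (hA : DifferentiableAt ℝ A z) (μ ν : E →L[ℝ] ℝ) :
    HasFDerivAt (fun w => ν (A w μ))
      ((ν.comp (ContinuousLinearMap.apply ℝ E μ)).comp (fderiv ℝ A z)) z :=
  HasFDerivAt.comp (g := ν.comp (ContinuousLinearMap.apply ℝ E μ)) z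
    (ContinuousLinearMap.hasFDerivAt _) hA.hasFDerivAt

section ChartTensor

open scoped Topology

variable {n : ℕ} {M : Type*} [TopologicalSpace M] [ChartedSpace (EuclideanSpace ℝ (Fin n)) M]

local notation "𝔼" => EuclideanSpace ℝ (Fin n)

instance (x : M) : FiniteDimensional ℝ (TangentSpace (𝓡 n) x) :=
  inferInstanceAs (FiniteDimensional ℝ (EuclideanSpace ℝ (Fin n)))

instance (x : M) : T2Space (TangentSpace (𝓡 n) x) :=
  inferInstanceAs (T2Space (EuclideanSpace ℝ (Fin n)))

theorem finrank_tangentSpace (x : M) : Module.finrank ℝ (TangentSpace (𝓡 n) x) = n :=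
  finrank_euclideanSpace_fin (𝕜 := ℝ) (n := n)

/-- The derivative at `x` of a chart of `M`. -/
noncomputable def chartDeriv (ψ : OpenPartialHomeomorph M (EuclideanSpace ℝ (Fin n))) (x : M) :
    TangentSpace (𝓡 n) x →L[ℝ] EuclideanSpace ℝ (Fin n) :=
  mfderiv (𝓡 n) (𝓡 n) ψ x

variable {ψ : OpenPartialHomeomorph M (EuclideanSpace ℝ (Fin n))}

theorem mdifferentiable_of_mem_maximalAtlas
    (hψ : ψ ∈ IsManifold.maximalAtlas (𝓡 n) ∞ M) : ψ.MDifferentiable (𝓡 n) (𝓡 n) :=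
  ⟨(contMDiffOn_of_mem_maximalAtlas hψ).mdifferentiableOn (by simp),
    (contMDiffOn_symm_of_mem_maximalAtlas hψ).mdifferentiableOn (by simp)⟩

theorem chartDeriv_bijective (hψ : ψ ∈ IsManifold.maximalAtlas (𝓡 n) ∞ M) {x : M}
    (hx : x ∈ ψ.source) : Function.Bijective (chartDeriv ψ x) := by
  exact (mdifferentiable_of_mem_maximalAtlas hψ).mfderiv_bijective hx

theorem differentialAt_comp_chart (hψ : ψ ∈ IsManifold.maximalAtlas (𝓡 n) ∞ M) {x : M}
    (hx : x ∈ ψ.source) {F : 𝔼 → ℝ} (hF : DifferentiableAt ℝ F (ψ x)) :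
    differentialAt n (F ∘ ψ) x = (fderiv ℝ F (ψ x)).comp (chartDeriv ψ x) := by
  unfold differentialAt chartDeriv
  rw [mfderiv_comp x (I' := 𝓡 n) hF.mdifferentiableAt
    ((mdifferentiable_of_mem_maximalAtlas hψ).mdifferentiableAt hx), mfderiv_eq_fderiv]
  rfl

namespace BivectorField

/-- The bivector field `π` written in a chart. -/
noncomputable def chartTensor (π : BivectorField n M)
    (ψ : OpenPartialHomeomorph M (EuclideanSpace ℝ (Fin n))) (z : EuclideanSpace ℝ (Fin n)) :
    (EuclideanSpace ℝ (Fin n) →L[ℝ] ℝ) →L[ℝ] EuclideanSpace ℝ (Fin n) :=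
  LinearMap.toContinuousLinearMap
    { toFun := fun α => chartDeriv ψ (ψ.symm z) (π.sharp (ψ.symm z) (α.comp (chartDeriv ψ (ψ.symm z))))
      map_add' := fun α β => by simp [ContinuousLinearMap.add_comp]
      map_smul' := fun c α => by simp [ContinuousLinearMap.smul_comp] }

theorem chartTensor_apply (π : BivectorField n M) {x : M} (hx : x ∈ ψ.source) (α : 𝔼 →L[ℝ] ℝ) :
    π.chartTensor ψ (ψ x) α = chartDeriv ψ x (π.sharp x (α.comp (chartDeriv ψ x))) := by
  have h : π.chartTensor ψ (ψ x) α = chartDeriv ψ (ψ.symm (ψ x))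
    (π.sharp (ψ.symm (ψ x)) (α.comp (chartDeriv ψ (ψ.symm (ψ x))))) := rfl
  rw [h, ψ.left_inv hx]

theorem chartTensor_skew (π : BivectorField n M) (z : 𝔼) (α β : 𝔼 →L[ℝ] ℝ) :
    β (π.chartTensor ψ z α) = -α (π.chartTensor ψ z β) :=
  π.skew (ψ.symm z) (α.comp (chartDeriv ψ (ψ.symm z))) (β.comp (chartDeriv ψ (ψ.symm z)))

theorem bracket_comp_chart (π : BivectorField n M) (hψ : ψ ∈ IsManifold.maximalAtlas (𝓡 n) ∞ M)
    {x : M} (hx : x ∈ ψ.source) {F G : 𝔼 → ℝ} (hF : DifferentiableAt ℝ F (ψ x))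
    (hG : DifferentiableAt ℝ G (ψ x)) :
    π.bracket (F ∘ ψ) (G ∘ ψ) x =
      fderiv ℝ G (ψ x) (π.chartTensor ψ (ψ x) (fderiv ℝ F (ψ x))) := by
  rw [bracket, differentialAt_comp_chart hψ hx hF, differentialAt_comp_chart hψ hx hG,
    chartTensor_apply π hx]
  rfl

theorem bracket_linear_comp_chart (π : BivectorField n M)
    (hψ : ψ ∈ IsManifold.maximalAtlas (𝓡 n) ∞ M) {x : M} (hx : x ∈ ψ.source) (α β : 𝔼 →L[ℝ] ℝ) :
    π.bracket (α ∘ ψ) (β ∘ ψ) x = β (π.chartTensor ψ (ψ x) α) := by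
  rw [bracket_comp_chart π hψ hx α.differentiableAt β.differentiableAt, α.fderiv, β.fderiv]

theorem rankAt_eq_finrank_range_chartTensor (π : BivectorField n M)
    (hψ : ψ ∈ IsManifold.maximalAtlas (𝓡 n) ∞ M) {x : M} (hx : x ∈ ψ.source) :
    π.rankAt x = Module.finrank ℝ (π.chartTensor ψ (ψ x)).range := by
  have hb := chartDeriv_bijective hψ hx
  have h : (π.chartTensor ψ (ψ x)).range = (π.leafTangent x).map (chartDeriv ψ x).toLinearMap := by
    ext v
    constructor
    · rintro ⟨α, rfl⟩
      exact ⟨_, ⟨α.comp (chartDeriv ψ x), rfl⟩, (chartTensor_apply π hx α).symm⟩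
    · rintro ⟨_, ⟨α, rfl⟩, rfl⟩
      let e := LinearEquiv.ofBijective (chartDeriv ψ x).toLinearMap hb
      refine ⟨α.comp (LinearMap.toContinuousLinearMap e.symm.toLinearMap), ?_⟩
      change π.chartTensor ψ (ψ x) _ = _
      rw [chartTensor_apply π hx]
      exact congrArg (fun a => chartDeriv ψ x (π.sharp x a))
        (ContinuousLinearMap.ext fun v => congrArg α (e.symm_apply_apply v))
  rw [h, finrank_map_of_disjoint_ker _ _ fun v _ hv => hb.1 (hv.trans (map_zero _).symm)]
  rfl

variable {π : BivectorField n M} [IsManifold (𝓡 n) ∞ M] [T2Space M]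

theorem IsPoissonOn.contDiffOn_chartTensor (hπ : π.IsPoissonOn Set.univ)
    (hψ : ψ ∈ IsManifold.maximalAtlas (𝓡 n) ∞ M) :
    ContDiffOn ℝ ∞ (π.chartTensor ψ) ψ.target := by
  have key : ∀ α β : 𝔼 →L[ℝ] ℝ,
      ContDiffOn ℝ ∞ (fun z => β (π.chartTensor ψ z α)) ψ.target := fun α β => by
    have h1 : ContMDiffOn (𝓡 n) 𝓘(ℝ, ℝ) ∞ (π.bracket (α ∘ ψ) (β ∘ ψ)) ψ.source := fun x hx =>
      (hπ.contMDiffAt_bracket (ψ.open_source.mem_nhds hx)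
        (α.contDiff.contMDiff.comp_contMDiffOn (contMDiffOn_of_mem_maximalAtlas hψ))
        (β.contDiff.contMDiff.comp_contMDiffOn
          (contMDiffOn_of_mem_maximalAtlas hψ))).contMDiffWithinAt
    have h2 := h1.comp (contMDiffOn_symm_of_mem_maximalAtlas hψ) ψ.mapsTo_symm
    refine (contMDiffOn_iff_contDiffOn.1 h2).congr fun z hz => ?_
    rw [Function.comp_apply, bracket_linear_comp_chart π hψ (ψ.map_target hz), ψ.right_inv hz]
  refine contDiffOn_clm_apply.2 fun α => contDiffOn_euclidean.2 fun i => ?_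
  exact key α (EuclideanSpace.proj i)

/-- For linear coordinate functions the inner bracket is a matrix entry of the tensor, and no second
derivatives of functions occur in the Jacobi identity. -/
theorem IsPoissonOn.jacobi_chartTensor (hπ : π.IsPoissonOn Set.univ)
    (hψ : ψ ∈ IsManifold.maximalAtlas (𝓡 n) ∞ M) {z : 𝔼} (hz : z ∈ ψ.target)
    (α β γ : 𝔼 →L[ℝ] ℝ) :
    γ (fderiv ℝ (π.chartTensor ψ) z (π.chartTensor ψ z α) β) +
      α (fderiv ℝ (π.chartTensor ψ) z (π.chartTensor ψ z β) γ) +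
      β (fderiv ℝ (π.chartTensor ψ) z (π.chartTensor ψ z γ) α) = 0 := by
  have hd : DifferentiableAt ℝ (π.chartTensor ψ) z :=
    ((hπ.contDiffOn_chartTensor hψ).contDiffAt (ψ.open_target.mem_nhds hz)).differentiableAt
      (by simp)
  have key : ∀ α β γ : 𝔼 →L[ℝ] ℝ, π.bracket (α ∘ ψ) (π.bracket (β ∘ ψ) (γ ∘ ψ)) (ψ.symm z) =
      γ (fderiv ℝ (π.chartTensor ψ) z (π.chartTensor ψ z α) β) := fun α β γ => by
    have h1 : π.bracket (β ∘ ψ) (γ ∘ ψ) =ᶠ[𝓝 (ψ.symm z)]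
        (fun w => γ (π.chartTensor ψ w β)) ∘ ψ := by
      filter_upwards [ψ.open_source.mem_nhds (ψ.map_target hz)] with y hy
      exact bracket_linear_comp_chart π hψ hy β γ
    have h2 := hasFDerivAt_dual_apply hd β γ
    rw [bracket_congr Filter.EventuallyEq.rfl h1,
      bracket_comp_chart π hψ (ψ.map_target hz) α.differentiableAt
        (by rw [ψ.right_inv hz]; exact h2.differentiableAt), ψ.right_inv hz, h2.fderiv, α.fderiv]
    rfl
  have hs : ∀ α : 𝔼 →L[ℝ] ℝ, ContMDiffOn (𝓡 n) 𝓘(ℝ, ℝ) ∞ (α ∘ ψ) ψ.source := fun α =>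
    α.contDiff.contMDiff.comp_contMDiffOn (contMDiffOn_of_mem_maximalAtlas hψ)
  rw [← key, ← key, ← key]
  exact hπ.jacobi_of_contMDiffOn (ψ.open_source.mem_nhds (ψ.map_target hz)) (hs α) (hs β) (hs γ)

end BivectorField

end ChartTensor

/-! ### Integral curves over unit time for small parameters. -/

section ParametricODE

set_option maxSynthPendingDepth 3

open scoped Topology NNReal
open Metric Set

/-- A family of vector fields depending linearly on a parameter `e` has integral curves defined on
`[0, 1]` and staying in a given neighbourhood, for all starting points close to a given one and all
small `e`. -/
theorem eventually_exists_integralCurve {X G : Type*} [NormedAddCommGroup X] [NormedSpace ℝ X]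
    [CompleteSpace X] [NormedAddCommGroup G] [NormedSpace ℝ G] {W : X → G →L[ℝ] X} {p : X}
    (hW : ContDiffAt ℝ 1 W p) {O : Set X} (hO : O ∈ 𝓝 p) :
    ∀ᶠ q : X × G in 𝓝 (p, 0), ∃ γ : ℝ → X, γ 0 = q.1 ∧ ∀ t ∈ Icc (0 : ℝ) 1,
      γ t ∈ O ∧ HasDerivWithinAt γ (W (γ t) q.2) (Icc 0 1) t := by
  obtain ⟨K, s, hs, hK⟩ := hW.exists_lipschitzOnWith
  have hbd : ∀ᶠ x in 𝓝 p, ‖W x‖ < ‖W p‖ + 1 :=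
    hW.continuousAt.norm.eventually (gt_mem_nhds (lt_add_one _))
  obtain ⟨ρ, hρ, hball⟩ := Metric.mem_nhds_iff.1 (Filter.inter_mem (Filter.inter_mem hs hbd) hO)
  lift ρ to ℝ≥0 using hρ.le
  set C : ℝ≥0 := ‖W p‖₊ + 1 with hC
  have hC0 : 0 < C := by positivity
  have h1 : ∀ᶠ q : X × G in 𝓝 (p, 0), q.1 ∈ ball p (ρ / 2) :=
    continuousAt_fst.eventually (ball_mem_nhds p (half_pos hρ))
  -- The speed is at most `C * ‖e‖`, so this bound keeps the displacement over unit time below `ρ /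
  -- 4`.
  have h2 : ∀ᶠ q : X × G in 𝓝 (p, 0), ‖q.2‖ < (ρ : ℝ) / 4 / C := by
    have : ContinuousAt (fun q : X × G => ‖q.2‖) (p, 0) := by fun_prop
    exact this.eventually (gt_mem_nhds (by simpa using by positivity))
  filter_upwards [h1, h2] with ⟨x, e⟩ hx he
  simp only at hx he ⊢
  have hsub : closedBall x (ρ / 4) ⊆ ball p ρ := fun y hy => by
    rw [mem_ball] at hx ⊢
    rw [mem_closedBall] at hy
    linarith [dist_triangle y x p]
  have hPL : IsPicardLindelof (fun _ y => W y e) (tmin := 0) (tmax := 1) ⟨0, by simp⟩ x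
      (ρ / 4) 0 (C * ‖e‖₊) (K * ‖e‖₊) := by
    refine .of_time_independent (fun y hy => ?_) ?_ ?_
    · have hy' : ‖W y‖ < C := (hball (hsub hy)).1.2
      exact ((W y).le_opNorm e).trans (mul_le_mul_of_nonneg_right hy'.le (norm_nonneg e))
    · refine LipschitzOnWith.of_dist_le_mul fun y hy z hz => ?_
      have := hK.dist_le_mul y (hball (hsub hy)).1.1 z (hball (hsub hz)).1.1
      rw [dist_eq_norm] at this ⊢
      rw [← sub_apply]
      refine ((W y - W z).le_opNorm e).trans ?_
      push_cast
      calc ‖W y - W z‖ * ‖e‖ ≤ (K * dist y z) * ‖e‖ := by gcongr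
        _ = K * ‖e‖ * dist y z := by ring
    · rw [lt_div_iff₀ (by exact_mod_cast hC0)] at he
      push_cast
      norm_num
      linarith [mul_comm (C : ℝ) ‖e‖]
  -- The fixed point of the Picard operator is used directly, because it carries the confinement to
  -- the closed ball of radius `ρ / 4`.
  obtain ⟨α, hα⟩ := ODE.FunSpace.exists_isFixedPt_next hPL (mem_closedBall_self le_rfl)
  have hmem : ∀ t, α.compProj t ∈ closedBall x (ρ / 4) := fun t =>
    α.compProj_mem_closedBall hPL.mul_max_le
  refine ⟨α.compProj, ?_, fun t ht => ⟨(hball (hsub (hmem t))).2, ?_⟩⟩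
  · have h0 : α.compProj ((⟨0, by simp⟩ : Icc (0 : ℝ) 1) : ℝ) = x := by
      rw [ODE.FunSpace.compProj_val, ← hα, ODE.FunSpace.next_apply₀]
    exact h0
  · refine (ODE.hasDerivWithinAt_picard_Icc (t₀ := 0) (by simp) hPL.continuousOn_uncurry
      α.continuous_compProj.continuousOn (fun t' _ => hmem t') x ht).congr_of_mem (fun t' ht' => ?_) ht
    nth_rw 1 [← hα]
    rw [ODE.FunSpace.compProj_of_mem ht', ODE.FunSpace.next_apply]

theorem eq_of_hasDerivWithinAt_zero {Y : Type*} [NormedAddCommGroup Y] [NormedSpace ℝ Y]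
    (f : ℝ → Y) (hf : ∀ t ∈ Icc (0 : ℝ) 1, HasDerivWithinAt f 0 (Icc 0 1) t) : f 0 = f 1 := by
  refine (convex_Icc (0 : ℝ) 1).is_const_of_fderivWithin_eq_zero (𝕜 := ℝ)
    (fun t ht => (hf t ht).differentiableWithinAt) (fun t ht => ?_) (by simp) (by simp)
  ext
  have := (hf t ht).derivWithin (uniqueDiffOn_Icc_zero_one t ht)
  simpa [derivWithin] using this

end ParametricODE

/-! ### Transport of the rank along the characteristic distribution. -/

section RankPropagation

set_option maxSynthPendingDepth 3

open scoped Topology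
open Set

variable {E F : Type*} [NormedAddCommGroup E] [NormedSpace ℝ E] [FiniteDimensional ℝ E]
  [NormedAddCommGroup F] [NormedSpace ℝ F]

/-- The infinitesimal invariance of a Poisson tensor along the vector field `A α`, for a fixed
covector `α`. -/
theorem fderiv_poissonTensor_apply {A : E → (E →L[ℝ] ℝ) →L[ℝ] E} {z : E}
    (hA : DifferentiableAt ℝ A z)
    (skew : ∀ (z : E) (α β : E →L[ℝ] ℝ), β (A z α) = -α (A z β))
    (jacobi : ∀ α β γ : E →L[ℝ] ℝ, γ (fderiv ℝ A z (A z α) β) + α (fderiv ℝ A z (A z β) γ) +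
      β (fderiv ℝ A z (A z γ) α) = 0) (α β : E →L[ℝ] ℝ) :
    fderiv ℝ A z (A z α) β =
      (fderiv ℝ A z).flip α (A z β) + A z (β.comp ((fderiv ℝ A z).flip α)) := by
  have hskew : ∀ (v : E) (μ ν : E →L[ℝ] ℝ), ν (fderiv ℝ A z v μ) = -μ (fderiv ℝ A z v ν) := by
    intro v μ ν
    have h1 : (fun w => ν (A w μ)) = fun w => -μ (A w ν) := funext fun w => skew w μ ν
    have h2 := hasFDerivAt_dual_apply hA μ ν
    rw [h1] at h2
    exact congrArg (· v) (h2.unique (hasFDerivAt_dual_apply hA ν μ).neg)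
  refine ext_of_forall_continuousDual fun γ => ?_
  have e := jacobi α β γ
  have e1 : γ (A z (β.comp ((fderiv ℝ A z).flip α))) = -β (fderiv ℝ A z (A z γ) α) := skew _ _ _
  have e2 := hskew (A z β) γ α
  rw [map_add, e1, ContinuousLinearMap.flip_apply]
  linarith

/-- If a Poisson tensor is, at `z₀`, nondegenerate in the directions of `pr : E → F`, then from every
point `z` near `z₀` there is a curve tangent to the characteristic distribution that leads to the
fibre of `pr` through `z₀`, and the rank at its end is at least the rank at `z`. -/
theorem eventually_exists_rank_le_on_fiber {A : E → (E →L[ℝ] ℝ) →L[ℝ] E} {z₀ : E} {Ω : Set E}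
    (hΩ : Ω ∈ 𝓝 z₀) (hA : ContDiffOn ℝ ∞ A Ω)
    (skew : ∀ (z : E) (α β : E →L[ℝ] ℝ), β (A z α) = -α (A z β))
    (jacobi : ∀ z ∈ Ω, ∀ α β γ : E →L[ℝ] ℝ, γ (fderiv ℝ A z (A z α) β) +
      α (fderiv ℝ A z (A z β) γ) + β (fderiv ℝ A z (A z γ) α) = 0)
    (pr : E →L[ℝ] F) {lam : E → F →L[ℝ] E →L[ℝ] ℝ} (hlam : ContDiffAt ℝ 1 lam z₀)
    (hpr : ∀ᶠ z in 𝓝 z₀, ∀ e, pr (A z (lam z e)) = -e) :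
    ∀ᶠ z in 𝓝 z₀, ∃ z' ∈ Ω, pr z' = pr z₀ ∧
      Module.finrank ℝ (A z).range ≤ Module.finrank ℝ (A z').range := by
  have hΩ' : interior Ω ∈ 𝓝 z₀ := interior_mem_nhds.2 hΩ
  have hA0 : ContDiffAt ℝ ∞ A z₀ := hA.contDiffAt hΩ
  have hdA : ContDiffAt ℝ 1 (fderiv ℝ A) z₀ := hA0.fderiv_right (by norm_cast)
  have hA1 : ContDiffAt ℝ 1 A z₀ := hA0.of_le (by norm_cast)
  let X := E × (E →L[ℝ] E)
  -- the vector field moves `z` along `A z (lam z e)` and transports covectors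
  let cmp := ContinuousLinearMap.compL ℝ E E E
  let W : X → F →L[ℝ] X := fun q =>
    ((A q.1).comp (lam q.1)).prod (-(cmp q.2).comp ((fderiv ℝ A q.1).flip.comp (lam q.1)))
  have hW : ContDiffAt ℝ 1 W (z₀, ContinuousLinearMap.id ℝ E) := by
    have a1 : ContDiffAt ℝ 1 (fun q : X => A q.1) (z₀, ContinuousLinearMap.id ℝ E) :=
      hA1.comp (z₀, ContinuousLinearMap.id ℝ E) contDiffAt_fst
    have a2 : ContDiffAt ℝ 1 (fun q : X => lam q.1) (z₀, ContinuousLinearMap.id ℝ E) :=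
      hlam.comp (z₀, ContinuousLinearMap.id ℝ E) contDiffAt_fst
    have a3 : ContDiffAt ℝ 1 (fun q : X => fderiv ℝ A q.1) (z₀, ContinuousLinearMap.id ℝ E) :=
      hdA.comp (z₀, ContinuousLinearMap.id ℝ E) contDiffAt_fst
    have a4 : ContDiffAt ℝ 1 (fun q : X => (fderiv ℝ A q.1).flip)
        (z₀, ContinuousLinearMap.id ℝ E) :=
      (ContinuousLinearMap.flipₗᵢ ℝ E (E →L[ℝ] ℝ) E).toContinuousLinearEquiv.contDiff.contDiffAt.comp
        (z₀, ContinuousLinearMap.id ℝ E) a3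
    have a5 : ContDiffAt ℝ 1 (fun q : X => cmp q.2) (z₀, ContinuousLinearMap.id ℝ E) :=
      cmp.contDiff.contDiffAt.comp (z₀, ContinuousLinearMap.id ℝ E) contDiffAt_snd
    have a6 := (a1.clm_comp a2)
    have a7 := (a5.clm_comp (a4.clm_comp a2)).neg
    exact (ContinuousLinearMap.prodₗᵢ ℝ).toContinuousLinearEquiv.contDiff.contDiffAt.comp
        (z₀, ContinuousLinearMap.id ℝ E) (a6.prodMk a7)
  have hO : (Prod.fst ⁻¹' (interior Ω ∩ {z | ∀ e, pr (A z (lam z e)) = -e}) : Set X) ∈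
      𝓝 (z₀, ContinuousLinearMap.id ℝ E) :=
    continuousAt_fst.preimage_mem_nhds (Filter.inter_mem hΩ' hpr)
  have hode := eventually_exists_integralCurve hW hO
  have hcont : Filter.Tendsto (fun z : E => ((z, ContinuousLinearMap.id ℝ E), pr z - pr z₀))
      (𝓝 z₀) (𝓝 ((z₀, ContinuousLinearMap.id ℝ E), 0)) := by
    have : Continuous (fun z : E => ((z, ContinuousLinearMap.id ℝ E), pr z - pr z₀)) := by fun_prop
    simpa using this.tendsto z₀
  filter_upwards [hcont.eventually hode] with z ⟨γ, hγ0, hγ⟩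
  -- With this parameter `pr` has constant velocity `-e` along the curve, so it goes from `pr z` to
  -- `pr z₀` in time 1.
  set e := pr z - pr z₀
  have hz : ∀ t ∈ Icc (0 : ℝ) 1,
      HasDerivWithinAt (fun t => (γ t).1) (A (γ t).1 (lam (γ t).1 e)) (Icc 0 1) t := fun t ht =>
    (hasFDerivAt_fst (𝕜 := ℝ) (p := γ t)).comp_hasDerivWithinAt t (hγ t ht).2
  have hg : ∀ t ∈ Icc (0 : ℝ) 1, HasDerivWithinAt (fun t => (γ t).2)
      (-(γ t).2.comp ((fderiv ℝ A (γ t).1).flip (lam (γ t).1 e))) (Icc 0 1) t := fun t ht =>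
    (hasFDerivAt_snd (𝕜 := ℝ) (p := γ t)).comp_hasDerivWithinAt t (hγ t ht).2
  have h11 : (1 : ℝ) ∈ Icc (0 : ℝ) 1 := by simp
  refine ⟨(γ 1).1, interior_subset (hγ 1 h11).1.1, ?_, ?_⟩
  · have h := eq_of_hasDerivWithinAt_zero (fun t => pr (γ t).1 + t • e) fun t ht => by
      have h1 := (pr.hasFDerivAt (x := (γ t).1)).comp_hasDerivWithinAt t (hz t ht)
      rw [(hγ t ht).1.2 e] at h1
      have h2 := ((hasDerivAt_id t).smul_const e).hasDerivWithinAt (s := Icc 0 1)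
      exact (h1.add h2).congr_deriv (by simp)
    simp only [zero_smul, add_zero, one_smul, hγ0] at h
    have h' : pr (γ 1).1 = pr z - e := eq_sub_of_add_eq h.symm
    rw [h', sub_sub_cancel]
  -- Write `g` for the transport and `B` for the derivative of `w ↦ A w μ` with the covector `μ =
  -- lam z e` frozen. Then `g' = -g B` and `A' = B A + A B*`, so `g A g*` is constant. Freezing `μ`
  -- is harmless: the invariance formula involves only its current value. No invertibility of `g` is
  -- needed for the one-sided rank estimate.
  · have hinv : ∀ α : E →L[ℝ] ℝ, A z α = (γ 1).2 (A (γ 1).1 (α.comp (γ 1).2)) := fun α => by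
      have h := eq_of_hasDerivWithinAt_zero (fun t => (γ t).2 (A (γ t).1 (α.comp (γ t).2))) fun t ht => by
        have hmem : Ω ∈ 𝓝 (γ t).1 := mem_interior_iff_mem_nhds.1 (hγ t ht).1.1
        have hd : DifferentiableAt ℝ A (γ t).1 :=
          (hA.contDiffAt hmem).differentiableAt (by simp)
        have h1 := hd.hasFDerivAt.comp_hasDerivWithinAt t (hz t ht)
        have h2 := ((ContinuousLinearMap.compL ℝ E E ℝ α).hasFDerivAt
          (x := (γ t).2)).comp_hasDerivWithinAt t (hg t ht)
        have h3 := (hg t ht).clm_apply (h1.clm_apply h2)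
        refine h3.congr_deriv ?_
        have key := fderiv_poissonTensor_apply hd skew
          (jacobi _ (interior_subset (hγ t ht).1.1)) (lam (γ t).1 e) (α.comp (γ t).2)
        simp only [Function.comp_apply, ContinuousLinearMap.compL_apply] at key ⊢
        rw [key, ContinuousLinearMap.comp_neg, map_neg, neg_apply,
          ContinuousLinearMap.comp_apply, map_add, map_add, map_neg,
          ContinuousLinearMap.comp_assoc]
        abel
      simpa [hγ0] using h
    have hle : (A z).range ≤ (A (γ 1).1).range.map (γ 1).2.toLinearMap := by
      rintro _ ⟨α, rfl⟩
      exact ⟨_, ⟨_, rfl⟩, (hinv α).symm⟩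
    exact (Submodule.finrank_mono hle).trans (Submodule.finrank_map_le _ _)

end RankPropagation

/-! ### Existence of the induced bivector at a point. -/

section LinearAlgebra

set_option maxSynthPendingDepth 3

theorem exists_comp_eq_of_ker_le {V W : Type*} [AddCommGroup V] [Module ℝ V] [TopologicalSpace V]
    [AddCommGroup W] [Module ℝ W] [TopologicalSpace W]
    [IsTopologicalAddGroup W] [ContinuousSMul ℝ W] [T2Space W] [FiniteDimensional ℝ W]
    {f : V →L[ℝ] W} (hf : Function.Surjective f) {α : V →L[ℝ] ℝ}
    (hα : ∀ v, f v = 0 → α v = 0) : ∃ a : W →L[ℝ] ℝ, a.comp f = α := by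
  obtain ⟨s, hs⟩ := f.toLinearMap.exists_rightInverse_of_surjective (LinearMap.range_eq_top.2 hf)
  have hs' : ∀ w, f (s w) = w := fun w => congrArg (· w) hs
  refine ⟨LinearMap.toContinuousLinearMap (α.toLinearMap ∘ₗ s), ?_⟩
  ext v
  change α (s (f v)) = α v
  rw [← sub_eq_zero, ← map_sub]
  exact hα _ (by rw [map_sub, hs', sub_self])

variable {V V' : Type*} [AddCommGroup V] [Module ℝ V] [TopologicalSpace V]
  [IsTopologicalAddGroup V] [ContinuousSMul ℝ V] [T2Space V] [FiniteDimensional ℝ V]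
  [AddCommGroup V'] [Module ℝ V'] [TopologicalSpace V']
  [IsTopologicalAddGroup V'] [ContinuousSMul ℝ V'] [T2Space V'] [FiniteDimensional ℝ V']

/-- The bivector is `P ∘ sharp ∘ P*`. Replacing `α` by `(α ∘ j) ∘ P` changes it by a covector
vanishing on `j.range`, whose image under `sharp` is killed by `P`. -/
theorem exists_induced_sharp {sharp : (V →L[ℝ] ℝ) →ₗ[ℝ] V} {j : V' →L[ℝ] V}
    (hj : Function.Injective j)
    (skew : ∀ α β : V →L[ℝ] ℝ, β (sharp α) = -α (sharp β))
    (nondeg : ∀ α ∈ continuousAnnihilator j.range, sharp α ∈ j.range → α = 0) :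
    ∃ sharpT : (V' →L[ℝ] ℝ) →ₗ[ℝ] V',
      (∀ α β : V' →L[ℝ] ℝ, β (sharpT α) = -α (sharpT β)) ∧
      ∀ α β : V →L[ℝ] ℝ, sharp α ∈ j.range →
        (β.comp j) (sharpT (α.comp j)) = β (sharp α) := by
  obtain ⟨P, hPj, hP, -⟩ := exists_poissonDirac_projection hj nondeg
  refine ⟨{ toFun := fun φ => P (sharp (φ.comp P))
            map_add' := fun a b => by simp [ContinuousLinearMap.add_comp]
            map_smul' := fun c a => by simp [ContinuousLinearMap.smul_comp] },
    fun α β => skew (α.comp P) (β.comp P), ?_⟩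
  rintro α β ⟨u, hu⟩
  have hu' : j u = sharp α := hu
  have h1 : P (sharp (α - (α.comp j).comp P)) = 0 := hP _ (by
    rintro _ ⟨v, rfl⟩
    simp [hPj])
  rw [map_sub, map_sub, sub_eq_zero] at h1
  change β (j (P (sharp ((α.comp j).comp P)))) = _
  rw [← h1, ← hu', hPj]

end LinearAlgebra

/-! ### Complete integrability as pointwise coisotropy. -/

section Foliation

set_option maxSynthPendingDepth 3

variable {n : ℕ} {M : Type*} [TopologicalSpace M] [ChartedSpace (EuclideanSpace ℝ (Fin n)) M]

theorem IsRegularFoliationOn.mono {D : TangentDistribution n M} {U U' : Set M} {r : ℕ}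
    (h : IsRegularFoliationOn D U r) (hU' : IsOpen U') (hsub : U' ⊆ U) :
    IsRegularFoliationOn D U' r := by
  intro x hx
  obtain ⟨V, hV, hxV, -, c, f, hc, hf, hD⟩ := h x (hsub hx)
  exact ⟨V ∩ U', hV.inter hU', ⟨hxV, hx⟩, Set.inter_subset_right, c, f, hc,
    hf.mono Set.inter_subset_left, fun y hy => hD y hy.1⟩

theorem IsRegularFoliationOn.finrank_eq {D : TangentDistribution n M} {U : Set M} {r : ℕ}
    (h : IsRegularFoliationOn D U r) {x : M} (hx : x ∈ U) : Module.finrank ℝ (D x) = r := by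
  obtain ⟨V, hV, hxV, -, c, f, hc, hf, hD⟩ := h x hx
  obtain ⟨hsurj, hker⟩ := hD x hxV
  have h1 : D x = (mfderiv (𝓡 n) (𝓡 c) f x).toLinearMap.ker := by
    ext v
    exact hker v
  have h2 := LinearMap.finrank_range_add_finrank_ker (mfderiv (𝓡 n) (𝓡 c) f x).toLinearMap
  rw [LinearMap.range_eq_top.2 hsurj, finrank_top, finrank_tangentSpace, finrank_tangentSpace,
    ← h1] at h2
  omega

/-- Linear functions of a local defining submersion are first integrals, and their differentials at
`x` fill the annihilator of `D x`. -/
theorem BivectorField.IsCompletelyIntegrableOn.apply_sharp_eq_zero {π : BivectorField n M}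
    {D : TangentDistribution n M} {U : Set M} {r : ℕ} (h : π.IsCompletelyIntegrableOn D U r)
    {x : M} (hx : x ∈ U) {α β : CotangentAt n x} (hα : α ∈ continuousAnnihilator (D x))
    (hβ : β ∈ continuousAnnihilator (D x)) : β (π.sharp x α) = 0 := by
  obtain ⟨V, hV, hxV, hVU, c, f, hc, hf, hD⟩ := h.2.1 x hx
  obtain ⟨hsurj, hker⟩ := hD x hxV
  have hd : ∀ y ∈ V, ∀ a : EuclideanSpace ℝ (Fin c) →L[ℝ] ℝ,
      differentialAt n (a ∘ f) y = a.comp (mfderiv (𝓡 n) (𝓡 c) f y) := fun y hy a => by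
    unfold differentialAt
    rw [mfderiv_comp y (I' := 𝓡 c) a.differentiableAt.mdifferentiableAt
      ((hf.contMDiffAt (hV.mem_nhds hy)).mdifferentiableAt (by simp)), mfderiv_eq_fderiv, a.fderiv]
    rfl
  have hfi : ∀ a : EuclideanSpace ℝ (Fin c) →L[ℝ] ℝ, IsFirstIntegralOn D V (a ∘ f) := fun a => by
    refine ⟨a.contDiff.contMDiff.comp_contMDiffOn hf, fun y hy v hv => ?_⟩
    rw [hd y hy]
    exact (congrArg a (((hD y hy).2 v).1 hv)).trans a.map_zero
  have hfac : ∀ γ ∈ continuousAnnihilator (D x),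
      ∃ a : EuclideanSpace ℝ (Fin c) →L[ℝ] ℝ, differentialAt n (a ∘ f) x = γ := fun γ hγ => by
    obtain ⟨a, ha⟩ := exists_comp_eq_of_ker_le (W := TangentSpace (𝓡 c) (f x)) hsurj
      fun v hv => hγ v ((hker v).2 hv)
    exact ⟨a, (hd x hxV a).trans ha⟩
  obtain ⟨a, rfl⟩ := hfac α hα
  obtain ⟨b, rfl⟩ := hfac β hβ
  exact h.2.2 V hV hVU (a ∘ f) (b ∘ f) (hfi a) (hfi b) x hxV

end Foliation

/-! ### Induced brackets through tangent extensions. -/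

section Submanifold

set_option maxSynthPendingDepth 3

open scoped Topology

variable {n k : ℕ} {M : Type*} [TopologicalSpace M] [ChartedSpace (EuclideanSpace ℝ (Fin n)) M]
  {T : Type*} [TopologicalSpace T] [ChartedSpace (EuclideanSpace ℝ (Fin k)) T]
  {π : BivectorField n M} {ι : T → M} {πT : BivectorField k T} {U : Set T}

theorem differentialAt_of_eventuallyEq_comp {f : T → ℝ} {f' : M → ℝ} {x : T}
    (hι : MDifferentiableAt (𝓡 k) (𝓡 n) ι x) (hf' : MDifferentiableAt (𝓡 n) 𝓘(ℝ, ℝ) f' (ι x))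
    (h : f =ᶠ[𝓝 x] f' ∘ ι) :
    differentialAt k f x = (differentialAt n f' (ι x)).comp (tangentMapAt n k ι x) := by
  rw [differentialAt_congr h]
  exact mfderiv_comp x hf' hι

theorem IsInducedPoissonDiracOn.bracket_eq (hT : IsInducedPoissonDiracOn π ι πT U) {x : T}
    (hx : x ∈ U) (hι : MDifferentiableAt (𝓡 k) (𝓡 n) ι x) {f g : T → ℝ} {f' g' : M → ℝ}
    (hf' : MDifferentiableAt (𝓡 n) 𝓘(ℝ, ℝ) f' (ι x))
    (hg' : MDifferentiableAt (𝓡 n) 𝓘(ℝ, ℝ) g' (ι x))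
    (hf : f =ᶠ[𝓝 x] f' ∘ ι) (hg : g =ᶠ[𝓝 x] g' ∘ ι)
    (htan : π.sharp (ι x) (differentialAt n f' (ι x)) ∈ submanifoldTangent n k ι x) :
    πT.bracket f g x = π.bracket f' g' (ι x) := by
  unfold BivectorField.bracket
  rw [differentialAt_of_eventuallyEq_comp hι hf' hf, differentialAt_of_eventuallyEq_comp hι hg' hg]
  exact (hT x hx).2 _ _ htan

/-- Every smooth function on `U` locally extends, along `ι`, to a function whose Hamiltonian vector
field is tangent to the submanifold. -/
def HasTangentExtensions (π : BivectorField n M) (ι : T → M) (U : Set T) : Prop :=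
  ∀ f : T → ℝ, ContMDiffOn (𝓡 k) 𝓘(ℝ, ℝ) ∞ f U → ∀ x ∈ U,
    ∃ f' : M → ℝ, ContMDiff (𝓡 n) 𝓘(ℝ, ℝ) ∞ f' ∧ f =ᶠ[𝓝 x] f' ∘ ι ∧
      ∀ᶠ y in 𝓝 x, π.sharp (ι y) (differentialAt n f' (ι y)) ∈ submanifoldTangent n k ι y

theorem IsInducedPoissonDiracOn.isPoissonOn
    (hT : IsInducedPoissonDiracOn π ι πT U) (hU : IsOpen U)
    (hπ : π.IsPoissonOn Set.univ) (hι : ContMDiff (𝓡 k) (𝓡 n) ∞ ι)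
    (hext : HasTangentExtensions (k := k) π ι U) : πT.IsPoissonOn U := by
  have hιd : ∀ x, MDifferentiableAt (𝓡 k) (𝓡 n) ι x := fun x => hι.mdifferentiable (by simp) x
  have key : ∀ {f g : T → ℝ} {f' g' : M → ℝ} {x : T}, x ∈ U →
      ContMDiff (𝓡 n) 𝓘(ℝ, ℝ) ∞ f' → ContMDiff (𝓡 n) 𝓘(ℝ, ℝ) ∞ g' → f =ᶠ[𝓝 x] f' ∘ ι →
      g =ᶠ[𝓝 x] g' ∘ ι →
      (∀ᶠ y in 𝓝 x, π.sharp (ι y) (differentialAt n f' (ι y)) ∈ submanifoldTangent n k ι y) →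
      πT.bracket f g =ᶠ[𝓝 x] π.bracket f' g' ∘ ι := by
    intro f g f' g' x hx hf' hg' hff' hgg' htan
    filter_upwards [hU.mem_nhds hx, hff'.eventuallyEq_nhds, hgg'.eventuallyEq_nhds, htan]
      with y hy hfy hgy hty
    exact hT.bracket_eq hy (hιd y) (hf'.mdifferentiable (by simp) _)
      (hg'.mdifferentiable (by simp) _) hfy hgy hty
  have hsm : ∀ {f' g' : M → ℝ}, ContMDiff (𝓡 n) 𝓘(ℝ, ℝ) ∞ f' → ContMDiff (𝓡 n) 𝓘(ℝ, ℝ) ∞ g' →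
      ContMDiff (𝓡 n) 𝓘(ℝ, ℝ) ∞ (π.bracket f' g') := fun hf hg =>
    contMDiffOn_univ.1 (hπ.1 _ _ hf.contMDiffOn hg.contMDiffOn)
  refine ⟨fun f g hf hg x hx => ?_, fun f g h hf hg hh x hx => ?_⟩
  · obtain ⟨f', hf', hff', htf⟩ := hext f hf x hx
    obtain ⟨g', hg', hgg', -⟩ := hext g hg x hx
    exact (((hsm hf' hg').comp hι).contMDiffAt.congr_of_eventuallyEq
      (key hx hf' hg' hff' hgg' htf)).contMDiffWithinAt
  · obtain ⟨f', hf', hff', htf⟩ := hext f hf x hx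
    obtain ⟨g', hg', hgg', htg⟩ := hext g hg x hx
    obtain ⟨h', hh', hhh', hth⟩ := hext h hh x hx
    -- `key` asks for tangency only of its first argument. Hence `{g', h'}` can serve as an
    -- extension of the inner bracket although its own Hamiltonian field is not known to be tangent.
    rw [(key hx hf' (hsm hg' hh') hff' (key hx hg' hh' hgg' hhh' htg) htf).eq_of_nhds,
      (key hx hg' (hsm hh' hf') hgg' (key hx hh' hf' hhh' hff' hth) htg).eq_of_nhds,
      (key hx hh' (hsm hf' hg') hhh' (key hx hf' hg' hff' hgg' htf) hth).eq_of_nhds]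
    exact hπ.2 f' g' h' hf'.contMDiffOn hg'.contMDiffOn hh'.contMDiffOn (ι x) trivial

end Submanifold

/-! ### Slice charts of an immersion and the transverse block of the tensor. -/

section SliceChart

set_option maxSynthPendingDepth 3

open scoped Topology

/-- Charts of `T` and `M` in which `ι : T → M` is the inclusion `u ↦ (u, 0)`. -/
structure SliceChart (n k : ℕ) {M : Type*} [TopologicalSpace M]
    [ChartedSpace (EuclideanSpace ℝ (Fin n)) M] {T : Type*} [TopologicalSpace T]
    [ChartedSpace (EuclideanSpace ℝ (Fin k)) T] (ι : T → M)
    (G : Type*) [NormedAddCommGroup G] [NormedSpace ℝ G] where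
  dom : OpenPartialHomeomorph T (EuclideanSpace ℝ (Fin k))
  cod : OpenPartialHomeomorph M (EuclideanSpace ℝ (Fin n))
  dom_mem : dom ∈ IsManifold.maximalAtlas (𝓡 k) ∞ T
  cod_mem : cod ∈ IsManifold.maximalAtlas (𝓡 n) ∞ M
  equiv : (EuclideanSpace ℝ (Fin k) × G) ≃L[ℝ] EuclideanSpace ℝ (Fin n)
  mapsTo : ∀ x ∈ dom.source, ι x ∈ cod.source
  apply_eq : ∀ x ∈ dom.source, cod (ι x) = equiv (dom x, 0)

variable {n k : ℕ} {M : Type*} [TopologicalSpace M] [ChartedSpace (EuclideanSpace ℝ (Fin n)) M]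
  {T : Type*} [TopologicalSpace T] [ChartedSpace (EuclideanSpace ℝ (Fin k)) T] {ι : T → M}

theorem exists_sliceChart (hι : Manifold.IsImmersion (𝓡 k) (𝓡 n) ∞ ι) (t : T) :
    ∃ (G : Type) (_ : NormedAddCommGroup G) (_ : NormedSpace ℝ G) (c : SliceChart n k ι G),
      t ∈ c.dom.source := by
  obtain ⟨G, i1, i2, h⟩ := hι.isImmersionAt t
  refine ⟨G, i1, i2, ⟨h.domChart, h.codChart, h.domChart_mem_maximalAtlas,
    h.codChart_mem_maximalAtlas, h.equiv, h.source_subset_preimage_source, fun x hx => ?_⟩,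
    h.mem_domChart_source⟩
  have hx' : h.domChart x ∈ (h.domChart.extend (𝓡 k)).target := by
    simpa using h.domChart.map_source hx
  have h1 := h.writtenInCharts hx'
  simpa [h.domChart.left_inv hx] using h1

namespace SliceChart

variable {G : Type*} [NormedAddCommGroup G] [NormedSpace ℝ G] (c : SliceChart n k ι G)

local notation "𝔼" => EuclideanSpace ℝ (Fin n)

/-- The coordinates along the submanifold. -/
noncomputable def along : EuclideanSpace ℝ (Fin n) →L[ℝ] EuclideanSpace ℝ (Fin k) :=
  (ContinuousLinearMap.fst ℝ _ G).comp c.equiv.symm.toContinuousLinearMap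

/-- The coordinates transverse to the submanifold. -/
noncomputable def pr : EuclideanSpace ℝ (Fin n) →L[ℝ] G :=
  (ContinuousLinearMap.snd ℝ (EuclideanSpace ℝ (Fin k)) G).comp c.equiv.symm.toContinuousLinearMap

theorem equiv_along_pr (z : 𝔼) : c.equiv (c.along z, c.pr z) = z := c.equiv.apply_symm_apply z

theorem along_equiv (u : EuclideanSpace ℝ (Fin k)) (g : G) : c.along (c.equiv (u, g)) = u :=
  congrArg Prod.fst (c.equiv.symm_apply_apply (u, g))

theorem pr_equiv (u : EuclideanSpace ℝ (Fin k)) (g : G) : c.pr (c.equiv (u, g)) = g :=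
  congrArg Prod.snd (c.equiv.symm_apply_apply (u, g))

theorem along_cod {x : T} (hx : x ∈ c.dom.source) : c.along (c.cod (ι x)) = c.dom x := by
  rw [c.apply_eq x hx, along_equiv]

theorem pr_cod {x : T} (hx : x ∈ c.dom.source) : c.pr (c.cod (ι x)) = 0 := by
  rw [c.apply_eq x hx, pr_equiv]

theorem cod_eq_of_pr_eq_zero {z : 𝔼} (h : c.pr z = 0) (hz : c.along z ∈ c.dom.target) :
    c.cod (ι (c.dom.symm (c.along z))) = z := by
  rw [c.apply_eq _ (c.dom.map_target hz), c.dom.right_inv hz, ← h, equiv_along_pr]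

theorem finiteDimensional (c : SliceChart n k ι G) : FiniteDimensional ℝ G :=
  have : FiniteDimensional ℝ (EuclideanSpace ℝ (Fin k) × G) :=
    c.equiv.symm.toLinearEquiv.finiteDimensional
  FiniteDimensional.of_surjective (LinearMap.snd ℝ (EuclideanSpace ℝ (Fin k)) G)
    LinearMap.snd_surjective

theorem chartDeriv_comp_tangentMapAt (hι : ContMDiff (𝓡 k) (𝓡 n) ∞ ι)
    {x : T} (hx : x ∈ c.dom.source) (v : TangentSpace (𝓡 k) x) :
    chartDeriv c.cod (ι x) (tangentMapAt n k ι x v) = c.equiv (chartDeriv c.dom x v, 0) := by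
  let L : EuclideanSpace ℝ (Fin k) →L[ℝ] 𝔼 :=
    c.equiv.toContinuousLinearMap.comp (ContinuousLinearMap.inl ℝ _ G)
  have h1 : c.cod ∘ ι =ᶠ[𝓝 x] L ∘ c.dom := by
    filter_upwards [c.dom.open_source.mem_nhds hx] with y hy
    exact c.apply_eq y hy
  have h2 := h1.mfderiv_eq (I := 𝓡 k) (I' := 𝓡 n)
  rw [mfderiv_comp x (I' := 𝓡 n)
      ((mdifferentiable_of_mem_maximalAtlas c.cod_mem).mdifferentiableAt (c.mapsTo x hx))
      (hι.mdifferentiable (by simp) x),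
    mfderiv_comp x (I' := 𝓡 k) L.differentiableAt.mdifferentiableAt
      ((mdifferentiable_of_mem_maximalAtlas c.dom_mem).mdifferentiableAt hx),
    mfderiv_eq_fderiv, L.fderiv] at h2
  exact congrArg (· v) h2

theorem tangentMapAt_injective (hι : ContMDiff (𝓡 k) (𝓡 n) ∞ ι)
    {x : T} (hx : x ∈ c.dom.source) : Function.Injective (tangentMapAt n k ι x) := by
  intro v w h
  have h1 := congrArg (chartDeriv c.cod (ι x)) h
  rw [chartDeriv_comp_tangentMapAt c hι hx, chartDeriv_comp_tangentMapAt c hι hx] at h1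
  exact (chartDeriv_bijective c.dom_mem hx).1 (congrArg Prod.fst (c.equiv.injective h1))

theorem mem_submanifoldTangent_iff (hι : ContMDiff (𝓡 k) (𝓡 n) ∞ ι)
    {x : T} (hx : x ∈ c.dom.source) (v : TangentSpace (𝓡 n) (ι x)) :
    v ∈ submanifoldTangent n k ι x ↔ c.pr (chartDeriv c.cod (ι x) v) = 0 := by
  constructor
  · rintro ⟨u, rfl⟩
    exact (congrArg c.pr (chartDeriv_comp_tangentMapAt c hι hx u)).trans (c.pr_equiv _ _)
  · intro h
    obtain ⟨u, hu⟩ := (chartDeriv_bijective c.dom_mem hx).2 (c.along (chartDeriv c.cod (ι x) v))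
    refine ⟨u, (chartDeriv_bijective c.cod_mem (c.mapsTo x hx)).1 ?_⟩
    refine (chartDeriv_comp_tangentMapAt c hι hx u).trans ?_
    rw [hu, ← h, equiv_along_pr]

theorem pr_comp_chartDeriv_surjective {x : T} (hx : x ∈ c.dom.source) :
    Function.Surjective (c.pr.comp (chartDeriv c.cod (ι x))) := by
  intro g
  obtain ⟨v, hv⟩ := (chartDeriv_bijective c.cod_mem (c.mapsTo x hx)).2 (c.equiv (0, g))
  exact ⟨v, (congrArg c.pr hv).trans (c.pr_equiv _ _)⟩

/-- Pull-back of covectors along the transverse coordinates. -/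
noncomputable def prDual : (G →L[ℝ] ℝ) →L[ℝ] (EuclideanSpace ℝ (Fin n) →L[ℝ] ℝ) :=
  (ContinuousLinearMap.compL ℝ (EuclideanSpace ℝ (Fin n)) G ℝ).flip c.pr

/-- The transverse part of a bivector field, in the coordinates of the slice chart. -/
noncomputable def transverseTensor (π : BivectorField n M) (z : EuclideanSpace ℝ (Fin n)) :
    (G →L[ℝ] ℝ) →L[ℝ] G :=
  c.pr.comp ((π.chartTensor c.cod z).comp c.prDual)

variable {π : BivectorField n M}

theorem transverseTensor_apply (z : 𝔼) (μ : G →L[ℝ] ℝ) :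
    c.transverseTensor π z μ = c.pr (π.chartTensor c.cod z (μ.comp c.pr)) := rfl

/-- The points at which the transverse part of a bivector field is nondegenerate. -/
def nondegenerateSet (π : BivectorField n M) : Set (EuclideanSpace ℝ (Fin n)) :=
  {z ∈ c.cod.target | (c.transverseTensor π z).IsInvertible}

/-- Conormal covectors are those factoring through `pr`, and tangent vectors are those killed by
`pr`; the transverse tensor is thus `π♯` on conormal covectors modulo tangent vectors. -/
theorem nondegenerate_of_isInvertible (hι : ContMDiff (𝓡 k) (𝓡 n) ∞ ι) {x : T}
    (hx : x ∈ c.dom.source) (hinv : (c.transverseTensor π (c.cod (ι x))).IsInvertible) :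
    ∀ α ∈ continuousAnnihilator (submanifoldTangent n k ι x),
      π.sharp (ι x) α ∈ submanifoldTangent n k ι x → α = 0 := by
  have := c.finiteDimensional
  intro α hα hsα
  obtain ⟨μ, rfl⟩ := exists_comp_eq_of_ker_le (c.pr_comp_chartDeriv_surjective hx)
    fun v hv => hα v ((c.mem_submanifoldTangent_iff hι hx v).2 hv)
  rw [c.mem_submanifoldTangent_iff hι hx] at hsα
  have h1 : c.transverseTensor π (c.cod (ι x)) μ = 0 := by
    rw [transverseTensor_apply, BivectorField.chartTensor_apply π (c.mapsTo x hx)]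
    exact hsα
  obtain ⟨e, he⟩ := hinv
  rw [← he] at h1
  have h2 : μ = 0 := e.injective (h1.trans (map_zero e).symm)
  rw [h2, ContinuousLinearMap.zero_comp]

/-- A kernel element gives a conormal `α` with `π♯ α` both tangent to the submanifold and
characteristic, so `π♯ α = 0`. By skewness `α` then vanishes on the characteristic subspace as well,
hence everywhere. -/
theorem isInvertible_of_isTransversalAt (hι : ContMDiff (𝓡 k) (𝓡 n) ∞ ι) {x : T}
    (hx : x ∈ c.dom.source) (htr : IsTransversalAt (k := k) π ι x) :
    (c.transverseTensor π (c.cod (ι x))).IsInvertible := by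
  have := c.finiteDimensional
  have hinj : Function.Injective (c.transverseTensor π (c.cod (ι x))) := by
    rw [injective_iff_map_eq_zero]
    intro μ hμ
    rw [transverseTensor_apply, BivectorField.chartTensor_apply π (c.mapsTo x hx)] at hμ
    set α : CotangentAt n (ι x) := (μ.comp c.pr).comp (chartDeriv c.cod (ι x)) with hα
    have h0 : π.sharp (ι x) α = 0 :=
      (Submodule.disjoint_def.1 htr.disjoint) _ ((c.mem_submanifoldTangent_iff hι hx _).2 hμ)
        ⟨α, rfl⟩
    have h1 : ∀ v, α v = 0 := fun v => by
      have hv : v ∈ submanifoldTangent n k ι x ⊔ π.leafTangent (ι x) := by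
        rw [htr.sup_eq_top]; trivial
      obtain ⟨u, hu, _, ⟨β, rfl⟩, rfl⟩ := Submodule.mem_sup.1 hv
      rw [map_add, π.skew, h0, map_zero, neg_zero, add_zero]
      exact (congrArg μ ((c.mem_submanifoldTangent_iff hι hx u).1 hu)).trans μ.map_zero
    ext g
    obtain ⟨v, rfl⟩ := c.pr_comp_chartDeriv_surjective hx g
    exact h1 v
  have hfin : Module.finrank ℝ (G →L[ℝ] ℝ) = Module.finrank ℝ G := by
    rw [← (LinearMap.toContinuousLinearMap : (G →ₗ[ℝ] ℝ) ≃ₗ[ℝ] (G →L[ℝ] ℝ)).finrank_eq]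
    exact Subspace.dual_finrank_eq
  exact ⟨(LinearEquiv.ofInjectiveOfFinrankEq (c.transverseTensor π (c.cod (ι x))).toLinearMap
    hinj hfin).toContinuousLinearEquiv, by ext; rfl⟩

theorem isOpen_along_preimage {U : Set T} (hU : IsOpen U) :
    IsOpen {z : 𝔼 | c.along z ∈ c.dom.target ∧ c.dom.symm (c.along z) ∈ U} :=
  (c.dom.isOpen_inter_preimage_symm hU).preimage c.along.continuous

variable [IsManifold (𝓡 n) ∞ M] [T2Space M]

theorem contDiffOn_transverseTensor (hπ : π.IsPoissonOn Set.univ) :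
    ContDiffOn ℝ ∞ (c.transverseTensor π) c.cod.target :=
  contDiffOn_const.clm_comp ((hπ.contDiffOn_chartTensor c.cod_mem).clm_comp contDiffOn_const)

theorem isOpen_nondegenerateSet (hπ : π.IsPoissonOn Set.univ) :
    IsOpen (c.nondegenerateSet π) := by
  have := c.finiteDimensional
  have : CompleteSpace G := FiniteDimensional.complete ℝ G
  have h := (c.contDiffOn_transverseTensor hπ).continuousOn.isOpen_inter_preimage
    c.cod.open_target (ContinuousLinearEquiv.isOpen (𝕜 := ℝ) (E := G →L[ℝ] ℝ) (F := G))
  exact h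

theorem contDiffOn_inverse_transverseTensor (hπ : π.IsPoissonOn Set.univ) :
    ContDiffOn ℝ ∞ (fun z => (c.transverseTensor π z).inverse) (c.nondegenerateSet π) := by
  have := c.finiteDimensional
  have : CompleteSpace G := FiniteDimensional.complete ℝ G
  rintro z ⟨hz, e, he⟩
  have h1 : ContDiffAt ℝ ∞ ContinuousLinearMap.inverse (c.transverseTensor π z) :=
    he ▸ contDiffAt_map_inverse e
  exact (h1.comp z ((c.contDiffOn_transverseTensor hπ).contDiffAt
    (c.cod.open_target.mem_nhds hz))).contDiffWithinAt

end SliceChart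

end SliceChart

/-! ### Tangent extensions, and points of maximal rank on the transversal. -/

section TangentExtensions

set_option maxSynthPendingDepth 3

open scoped Topology

variable {n k : ℕ} {M : Type*} [TopologicalSpace M] [ChartedSpace (EuclideanSpace ℝ (Fin n)) M]
  [IsManifold (𝓡 n) ∞ M] [T2Space M]
  {T : Type*} [TopologicalSpace T] [ChartedSpace (EuclideanSpace ℝ (Fin k)) T] {ι : T → M}
  {G : Type*} [NormedAddCommGroup G] [NormedSpace ℝ G] (c : SliceChart n k ι G)
  {π : BivectorField n M}

local notation "𝔼" => EuclideanSpace ℝ (Fin n)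

namespace SliceChart

/-- Extend `f` constantly in the transverse coordinates and add a term linear in them. That term
vanishes on the submanifold but changes the differential there by an arbitrary conormal covector,
chosen by inverting the transverse tensor to cancel the normal part of the Hamiltonian field. -/
theorem hasTangentExtensions (hπ : π.IsPoissonOn Set.univ) (hι : ContMDiff (𝓡 k) (𝓡 n) ∞ ι)
    {U : Set T} (hU : IsOpen U) (hUs : U ⊆ c.dom.source)
    (hUn : ∀ x ∈ U, c.cod (ι x) ∈ c.nondegenerateSet π) : HasTangentExtensions (k := k) π ι U := by
  intro f hf x hx
  set Ω : Set 𝔼 := {z | c.along z ∈ c.dom.target ∧ c.dom.symm (c.along z) ∈ U} ∩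
    c.nondegenerateSet π with hΩ
  have hΩo : IsOpen Ω := (c.isOpen_along_preimage hU).inter (c.isOpen_nondegenerateSet hπ)
  have hΩm : ∀ y ∈ U, c.cod (ι y) ∈ Ω := fun y hy => by
    refine ⟨⟨?_, ?_⟩, hUn y hy⟩
    · rw [c.along_cod (hUs hy)]; exact c.dom.map_source (hUs hy)
    · rw [c.along_cod (hUs hy), c.dom.left_inv (hUs hy)]; exact hy
  let f₀ : 𝔼 → ℝ := fun z => f (c.dom.symm (c.along z))
  have hf₀ : ContDiffOn ℝ ∞ f₀ Ω := by
    have h1 : ContMDiffOn (𝓡 k) 𝓘(ℝ, ℝ) ∞ (f ∘ c.dom.symm)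
        (c.dom.target ∩ c.dom.symm ⁻¹' U) :=
      hf.comp ((contMDiffOn_symm_of_mem_maximalAtlas c.dom_mem).mono Set.inter_subset_left)
        fun z hz => hz.2
    exact (contMDiffOn_iff_contDiffOn.1 h1).comp c.along.contDiff.contDiffOn fun z hz => hz.1
  let lam : 𝔼 → G →L[ℝ] ℝ := fun z =>
    -(c.transverseTensor π z).inverse (c.pr (π.chartTensor c.cod z (fderiv ℝ f₀ z)))
  have hlam : ContDiffOn ℝ ∞ lam Ω := by
    have h1 : ContDiffOn ℝ ∞ (fun z => c.pr (π.chartTensor c.cod z (fderiv ℝ f₀ z))) Ω :=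
      c.pr.contDiff.comp_contDiffOn (((hπ.contDiffOn_chartTensor c.cod_mem).mono
        fun z hz => hz.2.1).clm_apply (hf₀.fderiv_of_isOpen hΩo (by norm_cast)))
    exact (((c.contDiffOn_inverse_transverseTensor hπ).mono fun z hz => hz.2).clm_apply h1).neg
  let f₁ : 𝔼 → ℝ := fun z => f₀ z + lam z (c.pr z)
  have hf₁ : ContDiffOn ℝ ∞ f₁ Ω := hf₀.add (hlam.clm_apply c.pr.contDiff.contDiffOn)
  have hd₁ : ∀ z ∈ Ω, c.pr z = 0 → fderiv ℝ f₁ z = fderiv ℝ f₀ z + (lam z).comp c.pr := by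
    intro z hz hpr
    have h1 := ((hf₀.contDiffAt (hΩo.mem_nhds hz)).differentiableAt (by simp)).hasFDerivAt
    have h2 := ((hlam.contDiffAt (hΩo.mem_nhds hz)).differentiableAt (by simp)).hasFDerivAt
    have h3 := (h1.add (h2.clm_apply c.pr.hasFDerivAt)).fderiv
    refine h3.trans ?_
    rw [hpr]
    simp
  have hO : IsOpen (c.cod.source ∩ c.cod ⁻¹' Ω) := c.cod.isOpen_inter_preimage hΩo
  have hsm : ContMDiffOn (𝓡 n) 𝓘(ℝ, ℝ) ∞ (f₁ ∘ c.cod) (c.cod.source ∩ c.cod ⁻¹' Ω) :=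
    (contMDiffOn_iff_contDiffOn.2 hf₁).comp
      ((contMDiffOn_of_mem_maximalAtlas c.cod_mem).mono Set.inter_subset_left) fun y hy => hy.2
  obtain ⟨f', hf', hff'⟩ := exists_contMDiff_eventuallyEq
    (hO.mem_nhds ⟨c.mapsTo x (hUs hx), hΩm x hx⟩) hsm
  have hev := (hι.continuous.tendsto x).eventually hff'.eventuallyEq_nhds
  refine ⟨f', hf', ?_, ?_⟩
  · filter_upwards [hU.mem_nhds hx, hev] with y hy hye
    rw [Function.comp_apply, hye.eq_of_nhds, Function.comp_apply]
    simp only [f₁, f₀, c.pr_cod (hUs hy), map_zero, add_zero, c.along_cod (hUs hy),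
      c.dom.left_inv (hUs hy)]
  · filter_upwards [hU.mem_nhds hx, hev] with y hy hye
    have hys := hUs hy
    have hyc := c.mapsTo y hys
    rw [differentialAt_congr hye, differentialAt_comp_chart c.cod_mem hyc
      ((hf₁.contDiffAt (hΩo.mem_nhds (hΩm y hy))).differentiableAt (by simp)),
      c.mem_submanifoldTangent_iff hι hys, ← BivectorField.chartTensor_apply π hyc,
      hd₁ _ (hΩm y hy) (c.pr_cod hys), map_add, map_add, ← c.transverseTensor_apply]
    obtain ⟨e, he⟩ := (hUn y hy).2
    simp only [lam]
    rw [← he, ContinuousLinearMap.inverse_equiv, map_neg]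
    simp

theorem frequently_rankAt_eq {r : ℕ} (hπ : π.IsPoissonOn Set.univ)
    (hmax : ∀ x, π.rankAt x ≤ r) {t : T} (ht : t ∈ c.dom.source)
    (hnd : c.cod (ι t) ∈ c.nondegenerateSet π)
    (hrank : ι t ∈ closure {x | π.rankAt x = r}) {U : Set T} (hU : IsOpen U) (htU : t ∈ U) :
    ∃ x ∈ U, π.rankAt (ι x) = r := by
  have htc := c.mapsTo t ht
  -- The condition on `along` ensures that an end point with `pr = 0` is the image of a point of
  -- `U`.
  set Ω : Set 𝔼 := {z | c.along z ∈ c.dom.target ∧ c.dom.symm (c.along z) ∈ U} ∩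
    c.cod.target with hΩ
  have hΩo : IsOpen Ω := (c.isOpen_along_preimage hU).inter c.cod.open_target
  have hΩt : c.cod (ι t) ∈ Ω := by
    refine ⟨⟨?_, ?_⟩, c.cod.map_source htc⟩
    · rw [c.along_cod ht]; exact c.dom.map_source ht
    · rw [c.along_cod ht, c.dom.left_inv ht]; exact htU
  have hno := c.isOpen_nondegenerateSet hπ
  have key := eventually_exists_rank_le_on_fiber (hΩo.mem_nhds hΩt)
    ((hπ.contDiffOn_chartTensor c.cod_mem).mono Set.inter_subset_right)
    (π.chartTensor_skew)
    (fun z hz => hπ.jacobi_chartTensor c.cod_mem hz.2) c.pr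
    -- Conormal covectors suffice to steer `pr`: composed with `pr ∘ A` they give the transverse
    -- tensor, and the sign produces velocity `-e`.
    (lam := fun z => -c.prDual.comp (c.transverseTensor π z).inverse)
    (by
      have h1 := ((c.contDiffOn_inverse_transverseTensor hπ).contDiffAt (hno.mem_nhds hnd)).of_le
        (m := 1) (by norm_cast)
      exact (contDiffAt_const.clm_comp h1).neg)
    (by
      filter_upwards [hno.mem_nhds hnd] with z ⟨_, e, he⟩ g
      have h1 : c.transverseTensor π z ((c.transverseTensor π z).inverse g) = g := by
        rw [← he, ContinuousLinearMap.inverse_equiv]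
        exact e.apply_symm_apply g
      rw [c.transverseTensor_apply] at h1
      rw [neg_apply, map_neg, map_neg]
      exact congrArg Neg.neg h1)
  have hev : ∀ᶠ m in 𝓝 (ι t), m ∈ c.cod.source ∧ ∃ z' ∈ Ω, c.pr z' = c.pr (c.cod (ι t)) ∧
      Module.finrank ℝ (π.chartTensor c.cod (c.cod m)).range ≤
        Module.finrank ℝ (π.chartTensor c.cod z').range :=
    (c.cod.open_source.eventually_mem htc).and ((c.cod.continuousAt htc).eventually key)
  obtain ⟨m, hm, hms, z', hz', hpr, hle⟩ :=
    ((mem_closure_iff_frequently.1 hrank).and_eventually hev).exists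
  rw [c.pr_cod ht] at hpr
  have hcod := c.cod_eq_of_pr_eq_zero hpr hz'.1.1
  refine ⟨c.dom.symm (c.along z'), hz'.1.2, le_antisymm (hmax _) ?_⟩
  rw [← hcod, ← π.rankAt_eq_finrank_range_chartTensor c.cod_mem hms,
    ← π.rankAt_eq_finrank_range_chartTensor c.cod_mem
      (c.mapsTo _ (c.dom.map_target hz'.1.1))] at hle
  exact hm ▸ hle

end SliceChart

end TangentExtensions

/-! ### The main theorem. -/

theorem mainTheorem4 {n k r r' : ℕ}
    {M : Type*} [TopologicalSpace M] [T2Space M] [SecondCountableTopology M]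
    [ChartedSpace (EuclideanSpace ℝ (Fin n)) M] [IsManifold (𝓡 n) ∞ M]
    (π : BivectorField n M) (hπ : π.IsPoissonOn Set.univ)
    (F : TangentDistribution n M) (hF : π.IsCompletelyIntegrableOn F Set.univ r)
    (S : Set M) (hS : π.IsSymplecticLeaf S)
    (hdim : ∀ x ∈ S, Module.finrank ℝ (π.leafTangent x) = 2 * r')
    (hreg : π.IsRegularLeafFor F S)
    {T : Type*} [TopologicalSpace T] [T2Space T] [SecondCountableTopology T]
    [ChartedSpace (EuclideanSpace ℝ (Fin k)) T] [IsManifold (𝓡 k) ∞ T]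
    (ι : T → M) (hι : Manifold.IsImmersion (𝓡 k) (𝓡 n) ∞ ι)
    (t : T) (ht : ι t ∈ S) (htrans : IsTransversalAt (k := k) π ι t)
    (hcomp : IsCompatibleAt (k := k) F ι t (r - r'))
    (hrank : ι t ∈ closure {x | π.rankAt x = 2 * r}) :
    ∃ U₀ : Set T, IsOpen U₀ ∧ t ∈ U₀ ∧
      (∃ πT : BivectorField k T, IsInducedPoissonDiracOn π ι πT U₀) ∧
      ∀ πT : BivectorField k T, IsInducedPoissonDiracOn π ι πT U₀ →
        ∀ U : Set T, IsOpen U → U ⊆ U₀ → t ∈ U →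
          πT.IsPoissonOn U ∧
            πT.IsCompletelyIntegrableOn (restrictDistribution n k F ι) U (r - r') := by
  obtain ⟨G, _, _, c, htc⟩ := exists_sliceChart hι t
  obtain ⟨V, hV, htV, hfol⟩ := hcomp
  have hιs : ContMDiff (𝓡 k) (𝓡 n) ∞ ι := hι.contMDiff
  have hmax : ∀ x, π.rankAt x ≤ 2 * r := fun x => hF.1.2 ⟨x, trivial, rfl⟩
  -- This makes the natural-number subtraction `r - r'` a true difference.
  have hr : r' ≤ r := by
    have h1 : π.rankAt (ι t) = 2 * r' := hdim _ ht
    have h2 := hmax (ι t)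
    omega
  have hnk : k + 2 * r' = n := by
    have h1 := Submodule.finrank_add_eq_of_isCompl htrans
    have h2 : Module.finrank ℝ (submanifoldTangent n k ι t) = k :=
      (LinearMap.finrank_range_of_inj (c.tangentMapAt_injective hιs htc)).trans
        (finrank_tangentSpace t)
    rw [hdim _ ht, h2, finrank_tangentSpace] at h1
    exact h1
  let N : Set M := c.cod.source ∩ c.cod ⁻¹' c.nondegenerateSet π
  have hN : IsOpen N := c.cod.isOpen_inter_preimage (c.isOpen_nondegenerateSet hπ)
  let U₀ : Set T := V ∩ c.dom.source ∩ ι ⁻¹' N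
  have hnondeg : ∀ x ∈ U₀, ∀ α ∈ continuousAnnihilator (submanifoldTangent n k ι x),
      π.sharp (ι x) α ∈ submanifoldTangent n k ι x → α = 0 := fun x hx =>
    c.nondegenerate_of_isInvertible hιs hx.1.2 hx.2.2.2
  have hinj : ∀ x ∈ U₀, Function.Injective (tangentMapAt n k ι x) := fun x hx =>
    c.tangentMapAt_injective hιs hx.1.2
  have htnd : c.cod (ι t) ∈ c.nondegenerateSet π :=
    ⟨c.cod.map_source (c.mapsTo t htc), c.isInvertible_of_isTransversalAt hιs htc htrans⟩
  refine ⟨U₀, (hV.inter c.dom.open_source).inter (hN.preimage hιs.continuous),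
    ⟨⟨htV, htc⟩, c.mapsTo t htc, htnd⟩, ?_, ?_⟩
  · have hex : ∀ x : T, ∃ s : CotangentAt k x →ₗ[ℝ] TangentSpace (𝓡 k) x,
        (∀ α β : CotangentAt k x, β (s α) = -α (s β)) ∧
        (x ∈ U₀ → ∀ α β : CotangentAt n (ι x), π.sharp (ι x) α ∈ submanifoldTangent n k ι x →
          (β.comp (tangentMapAt n k ι x)) (s (α.comp (tangentMapAt n k ι x))) =
            β (π.sharp (ι x) α)) := fun x => by
      by_cases hx : x ∈ U₀
      · obtain ⟨s, hs, hsT⟩ := exists_induced_sharp (hinj x hx) (π.skew (ι x)) (hnondeg x hx)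
        exact ⟨s, hs, fun _ => hsT⟩
      -- A `BivectorField` is defined on all of `T`; off `U₀` the value is arbitrary.
      · exact ⟨0, fun α β => by simp, fun h => absurd h hx⟩
    choose s hs hsT using hex
    exact ⟨⟨s, hs⟩, fun x hx => ⟨fun α hα hsα => by rw [hnondeg x hx α hα hsα, map_zero],
      hsT x hx⟩⟩
  · intro πT hT U hU hUU₀ htU
    have hTU : IsInducedPoissonDiracOn π ι πT U := fun x hx => hT x (hUU₀ hx)
    have hrk : ∀ x ∈ U, πT.rankAt x + 2 * r' = π.rankAt (ι x) := fun x hx => by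
      have h1 := finrank_range_induced_sharp (hinj x (hUU₀ hx)) (π.skew (ι x))
        (hnondeg x (hUU₀ hx)) (hTU x hx).2
      rw [finrank_tangentSpace, finrank_tangentSpace] at h1
      change πT.rankAt x + n = π.rankAt (ι x) + k at h1
      omega
    refine ⟨hTU.isPoissonOn hU hπ hιs (c.hasTangentExtensions hπ hιs hU
      (fun x hx => (hUU₀ hx).1.2) fun x hx => (hUU₀ hx).2.2), ⟨?_, ?_⟩, ?_, ?_⟩
    · obtain ⟨x, hx, hxr⟩ := c.frequently_rankAt_eq hπ hmax htc htnd hrank hU htU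
      refine ⟨x, hx, ?_⟩
      have := hrk x hx
      omega
    · rintro _ ⟨x, hx, rfl⟩
      have h1 := hrk x hx
      have h2 := hmax (ι x)
      omega
    · exact hfol.mono hU fun x hx => (hUU₀ hx).1.1
    · intro W hW hWU f g hf hg x hx
      have hxU := hWU hx
      have hxU₀ := hUU₀ hxU
      -- Here `d = r'`: the foliation loses `r'` dimensions on restriction, which is half the
      -- codimension `n - k = 2 r'`.
      refine induced_sharp_involutive (hinj x hxU₀) (π.skew (ι x)) (hnondeg x hxU₀) (hTU x hxU).2
        (D := F (ι x)) (d := r')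
        (fun α hα β hβ => hF.apply_sharp_eq_zero trivial hα hβ) ?_ ?_ (hf.2 x hx) (hg.2 x hx)
      · have h1 := hfol.finrank_eq hxU₀.1.1
        rw [hF.2.1.finrank_eq trivial]
        change Module.finrank ℝ (restrictDistribution n k F ι x) + r' = r
        omega
      · rw [finrank_tangentSpace, finrank_tangentSpace]
        exact hnk
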